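/- Let $d\ge 2$, let $\Omega\subset\mathbb R^d$ be a bounded polytopic domain with a conforming simplicial mesh $\mathcal T_0$, and let $\mathbf A:\Omega\to\mathbb R^{d\times d}$ be Lipschitz on the interior of each element of $\mathcal T_0$, symmetric, and positive definite with smallest eigenvalue bounded away from $0$. For $u,v\in H^1_0(\Omega)$ put $a(u,v)=\int_\Omega \mathbf A\nabla u\cdot\nabla v$ and $\|v\|_a=\sqrt{a(v,v)}$; let $(\cdot,\cdot)$ be the inner product of $L^2(\Omega)$, and let $K:L^2(\Omega)\to H^1_0(\Omega)$ be the operator with $a(Kf,v)=(f,v)$ for all $f\in L^2(\Omega)$ and $v\in H^1_0(\Omega)$. Let $\{\mathcal T_h\}$ be a shape regular family of conforming simplicial meshes over $\Omega$, where $h$ is the largest diameter of an element of $\mathcal T_h$. Fix a degree $n\ge 1$. Let $S_0^h\subset H^1_0(\Omega)$ be the space of continuous functions on $\overline\Omega$ that are polynomials of degree at most $n$ on each element of $\mathcal T_h$ and vanish on $\partial\Omega$, and let $P_h:H^1_0(\Omega)\to S_0^h$ be the Galerkin projection, $a(v-P_hv,\chi)=0$ for all $\chi\in S_0^h$. Let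 $V:H^1_0(\Omega)\to L^2(\Omega)$ be linear and bounded, and assume that the homogeneous problem is non-resonant: if $w\in H^1_0(\Omega)$ and $a(w,v)+(Vw,v)=0$ for all $v\in H^1_0(\Omega)$, then $w=0$. Let $\ell:H^1_0(\Omega)\to L^2(\Omega)$ and $\ell_h:S_0^h\to L^2(\Omega)$ be operators, not necessarily linear. Let $u\in H^1_0(\Omega)$ and $u_h\in S_0^h$ satisfy $$a(u,v)+(Vu,v)=(\ell u,v)\quad\forall v\in H^1_0(\Omega),\qquad a(u_h,v)+(Vu_h,v)=(\ell_hu_h,v)\quad\forall v\in S_0^h,$$ and assume that there are a function $\kappa_1(h)\in(0,1)$ with $\kappa_1(h)\to0$ as $h\to0$ and a constant $C_1$ such that $\|K(\ell u-\ell_hu_h)\|_a\le C_1\,\kappa_1(h)\,\|u-u_h\|_a$ for all meshes of the family. Put $w^h=K(\ell_hu_h-Vu_h)$. Then there is $\kappa(h)\in(0,1)$ with $\kappa(h)\to0$ as $h\to0$ such that $$\|u-u_h\|_a=\|w^h-P_hw^h\|_a+\mathcal O(\kappa(h))\,\|u-u_h\|_a ,$$ that is, there is a constant $C$, independent of the mesh,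 with $$\bigl|\,\|u-u_h\|_a-\|w^h-P_hw^h\|_a\,\bigr|\le C\,\kappa(h)\,\|u-u_h\|_a$$ for all meshes of the family. -/

import Mathlib

open MeasureTheory Filter Topology
open scoped ContDiff

noncomputable section

namespace GalerkinFEM

variable {d : ℕ}

/-- Euclidean space `ℝ^d`. -/
abbrev Space (d : ℕ) : Type := EuclideanSpace ℝ (Fin d)

/-- A bounded polytopic domain: a bounded, nonempty, connected open set whose boundary consists of
finitely many flat pieces (convex hulls of finite point sets lying in a hyperplane). -/
structure IsPolytopicDomain (Ω : Set (Space d)) : Prop where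
  isOpen : IsOpen Ω
  isConnected : IsConnected Ω
  isBounded : Bornology.IsBounded Ω
  boundary : ∃ F : Set (Finset (Space d)), F.Finite ∧
    (∀ s ∈ F, affineSpan ℝ (s : Set (Space d)) ≠ ⊤) ∧
    frontier Ω = ⋃ s ∈ F, convexHull ℝ (s : Set (Space d))

/-! ### The spaces `L²(Ω)` and `H¹₀(Ω)` -/

/-- The space `L²(Ω)` of real functions. -/
abbrev L2 (Ω : Set (Space d)) : Type := Lp ℝ 2 (volume.restrict Ω)

/-- The space `L²(Ω)^d` of vector fields. -/
abbrev L2Vec (Ω : Set (Space d)) : Type := Lp (Space d) 2 (volume.restrict Ω)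

/-- The Hilbert space `L²(Ω) × L²(Ω)^d` with norm `(‖u‖² + ‖G‖²)^{1/2}`. On pairs `(u, ∇u)` this is
the norm of `H¹(Ω)`. -/
abbrev L2Pair (Ω : Set (Space d)) : Type := WithLp 2 (L2 Ω × L2Vec Ω)

/-- The pairs `(φ, ∇φ)` with `φ ∈ C_c^∞(Ω)`. -/
def testPairs (Ω : Set (Space d)) : Submodule ℝ (L2Pair Ω) where
  carrier := {p | ∃ φ : Space d → ℝ, ContDiff ℝ ∞ φ ∧ HasCompactSupport φ ∧ tsupport φ ⊆ Ω ∧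
    p.fst =ᵐ[volume.restrict Ω] φ ∧ p.snd =ᵐ[volume.restrict Ω] gradient φ}
  add_mem' := by
    rintro p q ⟨φ, hφ, hφc, hφs, hp1, hp2⟩ ⟨ψ, hψ, hψc, hψs, hq1, hq2⟩
    refine ⟨φ + ψ, hφ.add hψ, hφc.add hψc,
      (tsupport_add φ ψ).trans (Set.union_subset hφs hψs), ?_, ?_⟩
    · exact (Lp.coeFn_add _ _).trans (hp1.add hq1)
    · have hg : gradient (φ + ψ) = gradient φ + gradient ψ := by
        funext x
        have h1 := (hφ.differentiable (by simp)) x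
        have h2 := (hψ.differentiable (by simp)) x
        simp [gradient, fderiv_add h1 h2]
      rw [hg]
      exact (Lp.coeFn_add _ _).trans (hp2.add hq2)
  zero_mem' := by
    refine ⟨0, contDiff_const, HasCompactSupport.zero, by simp [tsupport], Lp.coeFn_zero _ _ _, ?_⟩
    have hg : gradient (0 : Space d → ℝ) = 0 := by
      funext x
      simp [gradient]
    rw [hg]
    exact Lp.coeFn_zero _ _ _
  smul_mem' := by
    rintro c p ⟨φ, hφ, hφc, hφs, hp1, hp2⟩
    refine ⟨c • φ, hφ.const_smul c, hφc.smul_left (f := fun _ => c),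
      (tsupport_smul_subset_right (fun _ => c) φ).trans hφs, ?_, ?_⟩
    · exact (Lp.coeFn_smul _ _).trans (hp1.const_smul c)
    · have hg : gradient (c • φ) = c • gradient φ := by
        funext x
        have h1 := (hφ.differentiable (by simp)) x
        simp [gradient, fderiv_const_smul h1]
      rw [hg]
      exact (Lp.coeFn_smul _ _).trans (hp2.const_smul c)

/-- `H¹₀(Ω)`, the closure of `C_c^∞(Ω)` in `H¹(Ω)`. An element is a pair `(u, G)`, a limit of pairs
`(φ, ∇φ)` of test functions, so that `G` is the weak gradient of `u`. -/
abbrev H10 (Ω : Set (Space d)) : Type := (testPairs Ω).topologicalClosure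

/-- The function underlying an element of `H¹₀(Ω)`, as an element of `L²(Ω)`. -/
def H10.fn {Ω : Set (Space d)} (u : H10 Ω) : L2 Ω := (u : L2Pair Ω).fst

/-- The weak gradient of an element of `H¹₀(Ω)`. -/
def H10.grad {Ω : Set (Space d)} (u : H10 Ω) : L2Vec Ω := (u : L2Pair Ω).snd

/-! ### Triangulations and finite element spaces -/

/-- A conforming simplicial mesh over `Ω`: a finite simplicial complex, all of whose faces belong
to a nondegenerate `d`-simplex of the complex, and whose simplices cover the closure of `Ω`. -/
structure Triangulation (Ω : Set (Space d)) where
  complex : Geometry.SimplicialComplex ℝ (Space d)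
  finite : complex.faces.Finite
  pure : ∀ s ∈ complex.faces, ∃ t ∈ complex.faces, s ⊆ t ∧ t.card = d + 1
  space_eq : complex.space = closure Ω

namespace Triangulation

variable {Ω : Set (Space d)}

/-- The elements `τ` of the mesh: its closed `d`-simplices. -/
def elements (T : Triangulation Ω) : Set (Set (Space d)) :=
  {τ | ∃ t ∈ T.complex.faces, t.card = d + 1 ∧ τ = convexHull ℝ (t : Set (Space d))}

/-- The mesh size `h = max {h_τ : τ ∈ T}`, where `h_τ` is the diameter of `τ`. -/
def meshSize (T : Triangulation Ω) : ℝ := sSup (Metric.diam '' T.elements)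

end Triangulation

/-- `ρ_τ`, the diameter of the largest ball contained in `τ`. -/
def inDiam (τ : Set (Space d)) : ℝ :=
  sSup {δ | ∃ (x : Space d) (r : ℝ), 0 ≤ r ∧ Metric.closedBall x r ⊆ τ ∧ δ = 2 * r}

/-- Shape regularity of a family of meshes: `h_τ / ρ_τ ≤ γ` for every element `τ` of every mesh. -/
def ShapeRegular {Ω : Set (Space d)} {ι : Type*} (T : ι → Triangulation Ω) : Prop :=
  ∃ γ : ℝ, ∀ i, ∀ τ ∈ (T i).elements, Metric.diam τ / inDiam τ ≤ γ

/-- `g` is a polynomial of degree at most `n` on the set `τ`. -/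
def IsPolyOn (n : ℕ) (τ : Set (Space d)) (g : Space d → ℝ) : Prop :=
  ∃ p : MvPolynomial (Fin d) ℝ, p.totalDegree ≤ n ∧
    ∀ x ∈ τ, g x = MvPolynomial.eval (fun k => x k) p

/-- The finite element space `S₀ʰ(Ω) ⊆ H¹₀(Ω)`: continuous functions on the closure of `Ω` that are
polynomials of degree at most `n` on each element of the mesh and vanish on the boundary. -/
def feSpace {Ω : Set (Space d)} (n : ℕ) (T : Triangulation Ω) : Submodule ℝ (H10 Ω) where
  carrier := {v | ∃ g : Space d → ℝ, ContinuousOn g (closure Ω) ∧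
    (∀ τ ∈ T.elements, IsPolyOn n τ g) ∧ (∀ x ∈ frontier Ω, g x = 0) ∧
    v.fn =ᵐ[volume.restrict Ω] g}
  add_mem' := by
    rintro v w ⟨g, hg, hgp, hg0, hv⟩ ⟨k, hk, hkp, hk0, hw⟩
    refine ⟨g + k, hg.add hk, ?_, fun x hx => by simp [hg0 x hx, hk0 x hx],
      (Lp.coeFn_add _ _).trans (hv.add hw)⟩
    intro τ hτ
    obtain ⟨p, hp, hpe⟩ := hgp τ hτ
    obtain ⟨q, hq, hqe⟩ := hkp τ hτ
    exact ⟨p + q, (MvPolynomial.totalDegree_add p q).trans (max_le hp hq),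
      fun x hx => by simp [hpe x hx, hqe x hx]⟩
  zero_mem' := ⟨0, continuousOn_const, fun τ _ => ⟨0, by simp, by simp⟩, by simp,
    Lp.coeFn_zero _ _ _⟩
  smul_mem' := by
    rintro c v ⟨g, hg, hgp, hg0, hv⟩
    refine ⟨c • g, hg.const_smul c, ?_, fun x hx => by simp [hg0 x hx],
      (Lp.coeFn_smul _ _).trans (hv.const_smul c)⟩
    intro τ hτ
    obtain ⟨p, hp, hpe⟩ := hgp τ hτ
    exact ⟨c • p, (MvPolynomial.totalDegree_smul_le c p).trans hp,
      fun x hx => by simp [hpe x hx]⟩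

/-! ### The bilinear form, the solution operator and the Galerkin projection -/

/-- A coefficient matrix field which is Lipschitz on the interior of each element of the mesh `T₀`,
symmetric, and positive definite with smallest eigenvalue bounded away from zero on `Ω`. -/
structure IsEllipticCoefficient {Ω : Set (Space d)} (T₀ : Triangulation Ω)
    (A : Space d → Matrix (Fin d) (Fin d) ℝ) : Prop where
  lipschitz : ∀ τ ∈ T₀.elements, ∀ k l, ∃ C : NNReal,
    LipschitzOnWith C (fun x => A x k l) (interior τ)
  symm : ∀ x ∈ Ω, (A x).IsSymm
  elliptic : ∃ α : ℝ, 0 < α ∧ ∀ x ∈ Ω, ∀ ξ : Space d,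
    α * ‖ξ‖ ^ 2 ≤ inner ℝ (Matrix.toEuclideanLin (A x) ξ) ξ

variable {Ω : Set (Space d)}

/-- The bilinear form `a(u, v) = (A ∇u, ∇v)`. -/
def energyForm (A : Space d → Matrix (Fin d) (Fin d) ℝ) (u v : H10 Ω) : ℝ :=
  ∫ x in Ω, inner ℝ (Matrix.toEuclideanLin (A x) (u.grad x)) (v.grad x)

/-- The energy norm `‖u‖_a = √a(u, u)`. -/
def energyNorm (A : Space d → Matrix (Fin d) (Fin d) ℝ) (u : H10 Ω) : ℝ :=
  √(energyForm A u u)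

/-- The solution operator `K : L²(Ω) → H¹₀(Ω)`: `K f` is the element of `H¹₀(Ω)` with
`a(K f, v) = (f, v)` for all `v ∈ H¹₀(Ω)`. -/
def solutionOp (A : Space d → Matrix (Fin d) (Fin d) ℝ) (f : L2 Ω) : H10 Ω :=
  Classical.epsilon fun w : H10 Ω => ∀ v : H10 Ω, energyForm A w v = inner ℝ f v.fn

/-- The Galerkin projection onto a subspace `S`: `P u` is the element of `S` with
`a(u - P u, v) = 0` for all `v ∈ S`. -/
def galerkinProj (A : Space d → Matrix (Fin d) (Fin d) ℝ) (S : Submodule ℝ (H10 Ω))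
    (u : H10 Ω) : H10 Ω :=
  Classical.epsilon fun p : H10 Ω => p ∈ S ∧ ∀ v ∈ S, energyForm A (u - p) v = 0

end GalerkinFEM

end

open GalerkinFEM

namespace GalerkinFEM

/-! ### Translation estimate and Poincaré inequality -/

/-! Write `M = K ∘ V`, `e = u - u_h`, `r = K(ℓu - ℓ_h u_h)`, `w = K(ℓ_h u_h - V u_h)` and `z = w -
u_h`. The discrete equation says exactly that `z` is `a`-orthogonal to `S₀ʰ`, so `u_h = P_h w` and
`‖z‖_a` is the computable quantity. Since `u = K(ℓu - Vu)`, subtraction gives `e - z = r - M e`. By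
the triangle inequality the claim reduces to showing that `‖M e‖_a` is of higher order, because `r`
is of order `κ₁(h) ‖e‖_a` by assumption. The operators `ℓ` and `ℓ_h` enter only through the values
`ℓu` and `ℓ_h u_h`, so their nonlinearity does no harm.

The operator `M` is compact, and `1 + M` is injective by non-resonance, hence invertible by the
Fredholm alternative. So `N = (1 + M)⁻¹ M` is compact and `N (1 + M) = M`
(`exists_comp_one_add_eq_of_isCompactOperator`). Applying `N` to `(1 + M) e = r + z` yields `M e = N
r + N z`. The first term is controlled by `r`. For the second, a compact operator is uniformly small
on vectors orthogonal to asymptotically dense subspaces (`exists_norm_le_of_orthogonal`), and `‖z‖`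
is bounded by `‖r‖` and `‖e‖`. No elliptic regularity is used: `κ` combines `κ₁` with a modulus
supplied by compactness.

Two analytic facts feed this argument. Compactness of `K` comes from Rellich's theorem, proved by
approximating test functions by averages over finitely many balls (`exists_finiteRank_approx`).
Asymptotic density of the spaces `S₀ʰ` comes from piecewise linear interpolation of test functions:
by shape regularity the interpolation error has Lipschitz constant of order `h`
(`Triangulation.exists_interpolant`), and compactly supported Lipschitz functions lie in `H¹₀` with
norm bounded by that constant (`exists_H10_of_lipschitz`). -/

/-- Cauchy–Schwarz inequality for the integral of `g` against the constant `1`. -/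
theorem enorm_integral_sq_le {α : Type*} [MeasurableSpace α] {μ : Measure α} {g : α → ℝ}
    (hg : AEMeasurable g μ) :
    ‖∫ x, g x ∂μ‖ₑ ^ 2 ≤ μ Set.univ * ∫⁻ x, ‖g x‖ₑ ^ 2 ∂μ := by
  have h := ENNReal.lintegral_mul_le_Lp_mul_Lq μ Real.HolderConjugate.two_two
    (f := fun x => ‖g x‖ₑ) (g := 1) hg.enorm aemeasurable_const
  simp only [mul_one, Pi.one_apply, one_div, ENNReal.rpow_two, one_pow, lintegral_one] at h
  have h2 : ∀ a : ENNReal, (a ^ (2⁻¹ : ℝ)) ^ 2 = a := fun a => by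
    rw [← ENNReal.rpow_two, ← ENNReal.rpow_mul]; norm_num
  calc ‖∫ x, g x ∂μ‖ₑ ^ 2 ≤ (∫⁻ x, ‖g x‖ₑ ∂μ) ^ 2 := by
        gcongr; exact enorm_integral_le_lintegral_enorm g
    _ ≤ ((∫⁻ x, ‖g x‖ₑ ^ 2 ∂μ) ^ (2⁻¹ : ℝ) * μ Set.univ ^ (2⁻¹ : ℝ)) ^ 2 := by gcongr
    _ = μ Set.univ * ∫⁻ x, ‖g x‖ₑ ^ 2 ∂μ := by rw [mul_pow, h2, h2, mul_comm]

theorem enorm_eLpNorm_two_sq {α E : Type*} [MeasurableSpace α] [NormedAddCommGroup E]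
    {μ : Measure α} (f : Lp E 2 μ) : ‖f‖ₑ ^ 2 = ∫⁻ x, ‖f x‖ₑ ^ 2 ∂μ := by
  rw [Lp.enorm_def, eLpNorm_eq_lintegral_rpow_enorm_toReal (by simp) (by simp)]
  simp only [ENNReal.toReal_ofNat, ENNReal.rpow_two, one_div]
  rw [← ENNReal.rpow_two, ← ENNReal.rpow_mul]; norm_num

theorem continuous_gradient_of_contDiff {d : ℕ} {φ : Space d → ℝ} (hφ : ContDiff ℝ ∞ φ) :
    Continuous (gradient φ) :=
  (InnerProductSpace.toDual ℝ (Space d)).symm.continuous.comp (hφ.continuous_fderiv (by simp))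

/-- The `L²` norm of a difference of translates is bounded by the norm of the gradient. -/
theorem lintegral_translate_sub_sq_le {d : ℕ} {φ : Space d → ℝ} (hφ : ContDiff ℝ ∞ φ)
    (z : Space d) :
    ∫⁻ x, ‖φ (x + z) - φ x‖ₑ ^ 2 ≤ ‖z‖ₑ ^ 2 * ∫⁻ x, ‖gradient φ x‖ₑ ^ 2 := by
  have hgc := continuous_gradient_of_contDiff hφ
  -- The fundamental theorem of calculus along the segment from `x` to `x + z`, then Cauchy–Schwarz
  -- in `t`. After integration in `x`, Tonelli and translation invariance remove the dependence on
  -- `t`.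
  have key : ∀ x, ‖φ (x + z) - φ x‖ₑ ^ 2 ≤
      ‖z‖ₑ ^ 2 * ∫⁻ t in Set.Ioc (0 : ℝ) 1, ‖gradient φ (x + t • z)‖ₑ ^ 2 := by
    intro x
    have hd : ∀ t ∈ Set.uIcc (0 : ℝ) 1, HasDerivAt (fun t : ℝ => φ (x + t • z))
        (inner ℝ (gradient φ (x + t • z)) z) t := by
      intro t _
      have h1 : HasDerivAt (fun t : ℝ => x + t • z) z t := by
        simpa using ((hasDerivAt_id t).smul_const z).const_add x
      have h2 := ((hφ.differentiable (by simp)) (x + t • z)).hasFDerivAt.comp_hasDerivAt t h1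
      convert! h2 using 1
      simp [gradient]
    have hc : Continuous fun t : ℝ => (inner ℝ (gradient φ (x + t • z)) z : ℝ) := by fun_prop
    have h3 := intervalIntegral.integral_eq_sub_of_hasDerivAt hd (hc.intervalIntegrable 0 1)
    simp only [one_smul, zero_smul, add_zero] at h3
    rw [← h3, intervalIntegral.integral_of_le zero_le_one]
    refine (enorm_integral_sq_le hc.aemeasurable).trans ?_
    simp only [MeasurableSet.univ, Measure.restrict_apply, Set.univ_inter, Real.volume_Ioc,
      sub_zero, ENNReal.ofReal_one, one_mul]
    rw [← lintegral_const_mul' _ _ (by simp)]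
    refine lintegral_mono fun t => ?_
    rw [← mul_pow]
    gcongr
    rw [mul_comm]
    simp only [← ofReal_norm, ← ENNReal.ofReal_mul (norm_nonneg _)]
    exact ENNReal.ofReal_le_ofReal (norm_inner_le_norm _ _)
  calc ∫⁻ x, ‖φ (x + z) - φ x‖ₑ ^ 2
      ≤ ∫⁻ x, ‖z‖ₑ ^ 2 * ∫⁻ t in Set.Ioc (0 : ℝ) 1, ‖gradient φ (x + t • z)‖ₑ ^ 2 :=
        lintegral_mono key
    _ = ‖z‖ₑ ^ 2 * ∫⁻ x, ∫⁻ t in Set.Ioc (0 : ℝ) 1, ‖gradient φ (x + t • z)‖ₑ ^ 2 := by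
        rw [lintegral_const_mul' _ _ (by simp)]
    _ = ‖z‖ₑ ^ 2 * ∫⁻ t in Set.Ioc (0 : ℝ) 1, ∫⁻ x, ‖gradient φ (x + t • z)‖ₑ ^ 2 := by
        rw [lintegral_lintegral_swap]
        exact (Continuous.aemeasurable (by fun_prop))
    _ = ‖z‖ₑ ^ 2 * ∫⁻ x, ‖gradient φ x‖ₑ ^ 2 := by
        congr 1
        simp_rw [lintegral_add_right_eq_self (fun x => ‖gradient φ x‖ₑ ^ 2)]
        simp

section TestFunctions

variable {d : ℕ} {Ω : Set (Space d)} {φ : Space d → ℝ}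

theorem gradient_eq_zero_of_tsupport_subset (hs : tsupport φ ⊆ Ω) {x : Space d} (hx : x ∉ Ω) :
    gradient φ x = 0 := by
  have : fderiv ℝ φ x = 0 := by
    by_contra h
    exact hx (hs (support_fderiv_subset ℝ h))
  simp [gradient, this]

theorem lintegral_enorm_sq_of_ae_eq {E : Type*} [NormedAddCommGroup E] {f : Space d → E}
    (hΩ : MeasurableSet Ω) {g : Lp E 2 (volume.restrict Ω)}
    (hg : g =ᵐ[volume.restrict Ω] f) (hf : ∀ x ∉ Ω, f x = 0) :
    ∫⁻ x, ‖f x‖ₑ ^ 2 = ‖g‖ₑ ^ 2 := by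
  rw [enorm_eLpNorm_two_sq, lintegral_congr_ae (g := fun x => ‖f x‖ₑ ^ 2)
    (hg.mono fun x hx => by simp [hx])]
  rw [← lintegral_indicator hΩ]
  refine lintegral_congr fun x => ?_
  by_cases hx : x ∈ Ω <;> simp [hx, hf]

/-- A closed property of pairs which holds for test functions holds on `H¹₀`. -/
theorem H10_induction {P : L2Pair Ω → Prop} (hc : IsClosed {p | P p})
    (ht : ∀ (p : L2Pair Ω) (φ : Space d → ℝ), ContDiff ℝ ∞ φ → HasCompactSupport φ →
      tsupport φ ⊆ Ω → p.fst =ᵐ[volume.restrict Ω] φ →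
      p.snd =ᵐ[volume.restrict Ω] gradient φ → P p) (u : H10 Ω) : P u :=
  closure_minimal (s := (testPairs Ω : Set (L2Pair Ω))) (t := {p | P p})
    (fun p ⟨φ, h1, h2, h3, h4, h5⟩ => ht p φ h1 h2 h3 h4 h5) hc u.2

/-- Poincaré's inequality on a bounded open set. -/
theorem exists_poincare (hd : 0 < d) (hΩ : IsOpen Ω) (hb : Bornology.IsBounded Ω) :
    ∃ C : ℝ, 0 ≤ C ∧ ∀ u : H10 Ω, ‖u.fn‖ ≤ C * ‖u.grad‖ := by
  obtain ⟨R, hR⟩ := hb.subset_closedBall 0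
  -- A translation longer than the diameter of the enclosing ball moves `Ω` off itself. Hence `φ(x +
  -- z) = 0` on `Ω`, and the translation estimate bounds `φ` itself.
  let z : Space d := EuclideanSpace.single ⟨0, hd⟩ (2 * |R| + 1)
  have hz : ‖z‖ = 2 * |R| + 1 := by
    simp only [z, PiLp.norm_single, Real.norm_eq_abs]
    exact abs_of_nonneg (by positivity)
  have hzΩ : ∀ x ∈ Ω, x + z ∉ Ω := by
    intro x hx hxz
    have h1 := mem_closedBall_zero_iff.1 (hR hx)
    have h2 := mem_closedBall_zero_iff.1 (hR hxz)
    have h3 : ‖z‖ ≤ ‖x + z‖ + ‖x‖ := by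
      simpa using norm_sub_le (x + z) x
    have := le_abs_self R
    linarith
  refine ⟨‖z‖, norm_nonneg z, fun u => H10_induction (P := fun p => ‖p.fst‖ ≤ ‖z‖ * ‖p.snd‖)
    ?_ ?_ u⟩
  · exact isClosed_le ((WithLp.fstL 2 ℝ _ _).continuous.norm)
      (continuous_const.mul (WithLp.sndL 2 ℝ _ _).continuous.norm)
  · intro p φ h1 _ h3 h4 h5
    have hφ0 : ∀ x ∉ Ω, φ x = 0 := fun x hx => image_eq_zero_of_notMem_tsupport fun h => hx (h3 h)
    have e1 := lintegral_enorm_sq_of_ae_eq hΩ.measurableSet h4 hφ0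
    have e2 := lintegral_enorm_sq_of_ae_eq hΩ.measurableSet h5
      (fun x hx => gradient_eq_zero_of_tsupport_subset h3 hx)
    have h6 := lintegral_translate_sub_sq_le h1 z
    have h7 : ∫⁻ x, ‖φ x‖ₑ ^ 2 ≤ ∫⁻ x, ‖φ (x + z) - φ x‖ₑ ^ 2 := by
      refine lintegral_mono fun x => ?_
      by_cases hx : x ∈ Ω
      · simp [hφ0 _ (hzΩ x hx)]
      · simp [hφ0 x hx]
    have h8 : ‖p.fst‖ₑ ^ 2 ≤ (‖z‖ₑ * ‖p.snd‖ₑ) ^ 2 := by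
      rw [mul_pow, ← e1, ← e2]; exact h7.trans h6
    have h9 : ‖p.fst‖ₑ ≤ ‖z‖ₑ * ‖p.snd‖ₑ := (ENNReal.pow_le_pow_left_iff two_ne_zero).1 h8
    simp only [← ofReal_norm, ← ENNReal.ofReal_mul (norm_nonneg _)] at h9
    exact (ENNReal.ofReal_le_ofReal_iff (by positivity)).1 h9

end TestFunctions

/-! ### Compactness of the embedding of `H¹₀` into `L²` -/

section Rellich

variable {d : ℕ} {Ω : Set (Space d)}

/-- The embedding of `H¹₀` into `L²` as a continuous linear map. -/
noncomputable def H10.fnL (Ω : Set (Space d)) : H10 Ω →L[ℝ] L2 Ω :=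
  (WithLp.fstL 2 ℝ (L2 Ω) (L2Vec Ω)).comp (testPairs Ω).topologicalClosure.subtypeL

@[simp] theorem H10.fnL_apply (u : H10 Ω) : H10.fnL Ω u = u.fn := rfl

theorem H10.norm_sq (u : H10 Ω) : ‖u‖ ^ 2 = ‖u.fn‖ ^ 2 + ‖u.grad‖ ^ 2 :=
  WithLp.prod_norm_sq_eq_of_L2 (u : L2Pair Ω)

theorem H10.norm_grad_le (u : H10 Ω) : ‖u.grad‖ ≤ ‖u‖ := by
  have := u.norm_sq
  exact abs_le_of_sq_le_sq' (by nlinarith [sq_nonneg ‖u.fn‖]) (norm_nonneg _) |>.2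

theorem volume_closedBall_two_mul (ε : ℝ) (hε : 0 < ε) :
    volume (Metric.closedBall (0 : Space d) (2 * ε)) =
      2 ^ d * volume (Metric.closedBall (0 : Space d) ε) := by
  rw [Measure.addHaar_closedBall _ _ (by positivity), Measure.addHaar_closedBall _ _ hε.le,
    finrank_euclideanSpace_fin, mul_pow, ENNReal.ofReal_mul (by positivity), mul_assoc]
  congr 1
  rw [ENNReal.ofReal_pow (by norm_num)]
  simp

/-- Cauchy–Schwarz for the average, then `B(y, ε) ⊆ B(x, 2ε)`. The bound no longer involves the
centre `y`, which may therefore depend on `x`. -/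
theorem enorm_sub_setAverage_sq_le {φ : Space d → ℝ} (hφ : Continuous φ) {x y : Space d} {ε : ℝ}
    (hε : 0 < ε) (hxy : dist y x ≤ ε) :
    ‖φ x - ⨍ w in Metric.closedBall y ε, φ w‖ₑ ^ 2 ≤
      (volume (Metric.closedBall (0 : Space d) ε))⁻¹ *
        ∫⁻ z in Metric.closedBall 0 (2 * ε), ‖φ (x + z) - φ x‖ₑ ^ 2 := by
  set μ : Measure (Space d) := volume.restrict (Metric.closedBall y ε) with hμ
  have hV : μ Set.univ = volume (Metric.closedBall (0 : Space d) ε) := by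
    rw [hμ, Measure.restrict_apply_univ, Measure.addHaar_closedBall_center]
  have hV0 : μ Set.univ ≠ 0 := by
    rw [hV]; exact (Metric.measure_closedBall_pos _ _ hε).ne'
  have hVt : μ Set.univ ≠ ⊤ := by
    rw [hV]; exact measure_closedBall_lt_top.ne
  have hint : Integrable φ μ :=
    hφ.continuousOn.integrableOn_compact (isCompact_closedBall y ε)
  have : NeZero μ := ⟨fun h => hV0 (by simp [h])⟩
  have : IsFiniteMeasure μ := ⟨hVt.lt_top⟩
  have h1 : φ x - ⨍ w, φ w ∂μ = ∫ w, (φ x - φ w) ∂((μ Set.univ)⁻¹ • μ) := by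
    rw [integral_sub (integrable_const _) hint.to_average, average]
    simp
  rw [h1]
  refine (enorm_integral_sq_le (by fun_prop)).trans ?_
  have hone : ((μ Set.univ)⁻¹ • μ) Set.univ = 1 := by
    simp
  rw [hone, lintegral_smul_measure, hV, one_mul, smul_eq_mul]
  refine mul_le_mul_right ?_ _
  calc ∫⁻ w in Metric.closedBall y ε, ‖φ x - φ w‖ₑ ^ 2
      ≤ ∫⁻ w in Metric.closedBall x (2 * ε), ‖φ x - φ w‖ₑ ^ 2 := by
        refine lintegral_mono_set (Metric.closedBall_subset_closedBall' ?_)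
        linarith
    _ = ∫⁻ z in Metric.closedBall 0 (2 * ε), ‖φ (x + z) - φ x‖ₑ ^ 2 := by
        rw [← lintegral_indicator Metric.isClosed_closedBall.measurableSet,
          ← lintegral_indicator Metric.isClosed_closedBall.measurableSet,
          ← lintegral_add_left_eq_self _ x]
        refine lintegral_congr fun z => ?_
        simp only [Set.indicator, Metric.mem_closedBall, dist_self_add_left, dist_zero_right]
        rw [← enorm_neg (φ x - _), neg_sub]

/-- A measurable map with finitely many values which moves the points of a bounded set by at most
`ε`. -/
theorem exists_simpleFunc_dist_le (hb : Bornology.IsBounded Ω) {ε : ℝ} (hε : 0 < ε) :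
    ∃ π : SimpleFunc (Space d) (Space d), ∀ x ∈ Ω, dist (π x) x ≤ ε := by
  have hc : IsCompact (closure Ω) := hb.isCompact_closure
  obtain ⟨t, ht⟩ := hc.elim_finite_subcover
    (fun n => Metric.ball (TopologicalSpace.denseSeq (Space d) n) ε)
    (fun n => Metric.isOpen_ball) (fun x _ => by
      obtain ⟨n, hn⟩ := (TopologicalSpace.denseRange_denseSeq (Space d)).exists_dist_lt x hε
      exact Set.mem_iUnion.2 ⟨n, hn⟩)
  refine ⟨SimpleFunc.nearestPt (TopologicalSpace.denseSeq (Space d)) (t.sup id), fun x hx => ?_⟩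
  obtain ⟨n, hn, hxn⟩ := Set.mem_iUnion₂.1 (ht (subset_closure hx))
  have h1 := SimpleFunc.edist_nearestPt_le (TopologicalSpace.denseSeq (Space d)) x
    (Finset.le_sup (f := id) hn)
  rw [edist_dist, edist_dist, ENNReal.ofReal_le_ofReal_iff dist_nonneg] at h1
  rw [Metric.mem_ball, dist_comm] at hxn
  exact h1.trans hxn.le

theorem coeFn_finset_sum_smul {α ι : Type*} [MeasurableSpace α] {μ : Measure α} (s : Finset ι)
    (k : ι → ℝ) (f : ι → Lp ℝ 2 μ) :
    (∑ i ∈ s, k i • f i : Lp ℝ 2 μ) =ᵐ[μ] fun x => ∑ i ∈ s, k i * f i x := by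
  classical
  induction s using Finset.induction with
  | empty => simp only [Finset.sum_empty]; exact Lp.coeFn_zero ℝ 2 μ
  | insert a s ha ih =>
    rw [Finset.sum_insert ha]
    filter_upwards [Lp.coeFn_add (k a • f a) (∑ i ∈ s, k i • f i), Lp.coeFn_smul (k a) (f a), ih]
      with x h1 h2 h3
    rw [h1, Pi.add_apply, h2, h3, Finset.sum_insert ha]
    rfl

theorem isCompactOperator_rankOne {E F : Type*} [NormedAddCommGroup E] [InnerProductSpace ℝ E]
    [NormedAddCommGroup F] [InnerProductSpace ℝ F] (x : E) (y : F) :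
    IsCompactOperator (InnerProductSpace.rankOne ℝ x y) := by
  rw [InnerProductSpace.rankOne_def']
  exact ((isCompactOperator_id (E := ℝ)).comp_clm (innerSL ℝ y)).clm_comp
    (ContinuousLinearMap.toSpanSingleton ℝ x)

/-- Approximation of the identity on `H¹₀` by local averages, in the norm of `L²`. -/
theorem exists_finiteRank_approx (hΩ : IsOpen Ω) (hb : Bornology.IsBounded Ω) {ε : ℝ}
    (hε : 0 < ε) :
    ∃ R : L2 Ω →L[ℝ] L2 Ω, IsCompactOperator (ContinuousLinearMap.adjoint R) ∧
      ∀ u : H10 Ω, ‖u.fn - R u.fn‖ ^ 2 ≤ 2 ^ d * (2 * ε) ^ 2 * ‖u.grad‖ ^ 2 := by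
  obtain ⟨π, hπ⟩ := exists_simpleFunc_dist_le hb hε
  have : IsFiniteMeasure (volume.restrict Ω) := ⟨by
    rw [Measure.restrict_apply_univ]; exact hb.measure_lt_top⟩
  set c : ℝ := (volume.real (Metric.closedBall (0 : Space d) ε))⁻¹ with hc
  -- `a y` is the indicator of the ball averaged over, and `b y` that of the cell where `π` takes
  -- the value `y`. The operator `f ↦ ∑ c ⟨a y, f⟩ b y` replaces `f` on each cell by its average
  -- over the ball around `π x`.
  let a : Space d → L2 Ω := fun y =>
    indicatorConstLp 2 (Metric.isClosed_closedBall (x := y) (ε := ε)).measurableSet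
      (measure_ne_top _ _) 1
  let b : Space d → L2 Ω := fun y =>
    indicatorConstLp 2 (π.measurableSet_fiber y) (measure_ne_top _ _) 1
  refine ⟨∑ y ∈ π.range, c • InnerProductSpace.rankOne ℝ (b y) (a y), ?_, ?_⟩
  · rw [map_sum]
    refine Submodule.sum_mem (compactOperator (RingHom.id ℝ) (L2 Ω) (L2 Ω)) fun y _ => ?_
    rw [map_smulₛₗ, InnerProductSpace.adjoint_rankOne]
    exact Submodule.smul_mem _ _ (isCompactOperator_rankOne _ _)
  · intro u
    refine H10_induction (P := fun p => ‖p.fst - (∑ y ∈ π.range,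
      c • InnerProductSpace.rankOne ℝ (b y) (a y)) p.fst‖ ^ 2 ≤
        2 ^ d * (2 * ε) ^ 2 * ‖p.snd‖ ^ 2) ?_ ?_ u
    · have h1 := (WithLp.fstL 2 ℝ (L2 Ω) (L2Vec Ω)).continuous
      have h2 := (WithLp.sndL 2 ℝ (L2 Ω) (L2Vec Ω)).continuous
      exact isClosed_le ((h1.sub (ContinuousLinearMap.continuous _ |>.comp h1)).norm.pow 2)
        (continuous_const.mul (h2.norm.pow 2))
    · intro p φ h1 h2 h3 h4 h5
      set R := ∑ y ∈ π.range, c • InnerProductSpace.rankOne ℝ (b y) (a y) with hR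
      have hφ0 : ∀ x ∉ Ω, φ x = 0 :=
        fun x hx => image_eq_zero_of_notMem_tsupport fun h => hx (h3 h)
      have hav : ∀ y, c * inner ℝ (a y) p.fst = ⨍ w in Metric.closedBall y ε, φ w := by
        intro y
        rw [setAverage_eq, hc, Measure.real, Measure.real, Measure.addHaar_closedBall_center volume y]
        simp only [a, smul_eq_mul]
        congr 1
        rw [L2.inner_indicatorConstLp_one, integral_congr_ae (ae_restrict_of_ae h4),
          Measure.restrict_restrict Metric.isClosed_closedBall.measurableSet,
          setIntegral_eq_of_subset_of_forall_sdiff_eq_zero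
            Metric.isClosed_closedBall.measurableSet Set.inter_subset_left]
        exact fun x hx => hφ0 x fun h => hx.2 ⟨hx.1, h⟩
      have hRp : R p.fst =ᵐ[volume.restrict Ω]
          fun x => ⨍ w in Metric.closedBall (π x) ε, φ w := by
        have e1 : R p.fst = ∑ y ∈ π.range, (⨍ w in Metric.closedBall y ε, φ w) • b y := by
          rw [hR, sum_apply]
          refine Finset.sum_congr rfl fun y _ => ?_
          rw [smul_apply, InnerProductSpace.rankOne_apply, smul_smul, hav]
        rw [e1]
        have hb' : ∀ᵐ x ∂(volume.restrict Ω), ∀ y ∈ π.range,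
            b y x = (π ⁻¹' {y}).indicator (fun _ => (1 : ℝ)) x :=
          (Finset.eventually_all _).2 fun y _ => indicatorConstLp_coeFn
        filter_upwards [coeFn_finset_sum_smul π.range _ b, hb'] with x hx1 hx2
        rw [hx1, Finset.sum_eq_single_of_mem (π x) (SimpleFunc.mem_range_self π x),
          hx2 _ (SimpleFunc.mem_range_self π x)]
        · simp
        · intro y hy hne
          rw [hx2 y hy, Set.indicator_of_notMem, mul_zero]
          exact fun h => hne h.symm
      set V := volume (Metric.closedBall (0 : Space d) ε) with hV
      have hV0 : V ≠ 0 := (Metric.measure_closedBall_pos _ _ hε).ne'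
      have hVt : V ≠ ⊤ := measure_closedBall_lt_top.ne
      have hcφ := h1.continuous
      have e2 := lintegral_enorm_sq_of_ae_eq hΩ.measurableSet h5
        (fun x hx => gradient_eq_zero_of_tsupport_subset h3 hx)
      -- The error is bounded through translates by `|z| ≤ 2ε`, each controlled by the gradient. The
      -- factor `2 ^ d` is the ratio of the volumes of the balls of radii `2ε` and `ε`.
      have key : ‖p.fst - R p.fst‖ₑ ^ 2 ≤ 2 ^ d * ENNReal.ofReal (2 * ε) ^ 2 * ‖p.snd‖ₑ ^ 2 := by
        calc ‖p.fst - R p.fst‖ₑ ^ 2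
            = ∫⁻ x in Ω, ‖φ x - ⨍ w in Metric.closedBall (π x) ε, φ w‖ₑ ^ 2 := by
              rw [enorm_eLpNorm_two_sq]
              refine lintegral_congr_ae ?_
              filter_upwards [Lp.coeFn_sub p.fst (R p.fst), h4, hRp] with x k1 k2 k3
              rw [k1, Pi.sub_apply, k2, k3]
          _ ≤ ∫⁻ x in Ω, V⁻¹ *
                ∫⁻ z in Metric.closedBall 0 (2 * ε), ‖φ (x + z) - φ x‖ₑ ^ 2 :=
              setLIntegral_mono' hΩ.measurableSet fun x hx =>
                enorm_sub_setAverage_sq_le hcφ hε (hπ x hx)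
          _ ≤ ∫⁻ x, V⁻¹ *
                ∫⁻ z in Metric.closedBall 0 (2 * ε), ‖φ (x + z) - φ x‖ₑ ^ 2 :=
              setLIntegral_le_lintegral _ _
          _ = V⁻¹ * ∫⁻ z in Metric.closedBall 0 (2 * ε), ∫⁻ x, ‖φ (x + z) - φ x‖ₑ ^ 2 := by
              rw [lintegral_const_mul' _ _ (by simpa using hV0), lintegral_lintegral_swap]
              exact Continuous.aemeasurable (by fun_prop)
          _ ≤ V⁻¹ * ∫⁻ z in Metric.closedBall (0 : Space d) (2 * ε),
                ENNReal.ofReal (2 * ε) ^ 2 * ‖p.snd‖ₑ ^ 2 := by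
              gcongr V⁻¹ * ?_
              refine setLIntegral_mono' Metric.isClosed_closedBall.measurableSet fun z hz => ?_
              refine (lintegral_translate_sub_sq_le h1 z).trans ?_
              rw [e2, ← ofReal_norm]
              gcongr
              exact mem_closedBall_zero_iff.1 hz
          _ = 2 ^ d * ENNReal.ofReal (2 * ε) ^ 2 * ‖p.snd‖ₑ ^ 2 := by
              rw [setLIntegral_const, volume_closedBall_two_mul ε hε, ← hV]
              calc V⁻¹ * (ENNReal.ofReal (2 * ε) ^ 2 * ‖p.snd‖ₑ ^ 2 * (2 ^ d * V))
                  = (V⁻¹ * V) * (2 ^ d * ENNReal.ofReal (2 * ε) ^ 2 * ‖p.snd‖ₑ ^ 2) := by ring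
                _ = _ := by rw [ENNReal.inv_mul_cancel hV0 hVt, one_mul]
      have e3 : (2 : ENNReal) ^ d = ENNReal.ofReal (2 ^ d) := by
        rw [ENNReal.ofReal_pow (by norm_num)]; simp
      rw [e3] at key
      simp only [← ofReal_norm] at key
      rw [← ENNReal.ofReal_pow (by positivity), ← ENNReal.ofReal_pow (by positivity),
        ← ENNReal.ofReal_pow (by positivity), ← ENNReal.ofReal_mul (by positivity),
        ← ENNReal.ofReal_mul (by positivity)] at key
      exact (ENNReal.ofReal_le_ofReal_iff (by positivity)).1 key

/-- The adjoint of the embedding of `H¹₀` into `L²` is compact. -/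
theorem isCompactOperator_adjoint_fnL (hΩ : IsOpen Ω) (hb : Bornology.IsBounded Ω) :
    IsCompactOperator (ContinuousLinearMap.adjoint (H10.fnL Ω)) := by
  have h := fun n : ℕ => exists_finiteRank_approx hΩ hb (ε := 1 / ((n : ℝ) + 1)) (by positivity)
  choose R hR1 hR2 using h
  -- With `J` the embedding, `R n ∘ J → J` in operator norm, so the adjoints `J* ∘ (R n)*` converge
  -- to `J*`. Working with adjoints throughout makes Schauder's theorem unnecessary.
  refine isCompactOperator_of_tendsto (l := atTop)
    (F := fun n => ContinuousLinearMap.adjoint ((R n).comp (H10.fnL Ω))) ?_ ?_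
  · refine (ContinuousLinearMap.adjoint.continuous.tendsto _).comp ?_
    rw [tendsto_iff_norm_sub_tendsto_zero]
    have hlim : Tendsto (fun n : ℕ => √(2 ^ d) * 2 * (1 / ((n : ℝ) + 1))) atTop (𝓝 0) := by
      simpa using tendsto_one_div_add_atTop_nhds_zero_nat.const_mul (√(2 ^ d) * 2)
    refine squeeze_zero (fun n => by positivity) (fun n => ?_) hlim
    refine ContinuousLinearMap.opNorm_le_bound _ (by positivity) fun u => ?_
    have h1 := hR2 n u
    have h2 := u.norm_grad_le
    rw [norm_sub_rev] at h1
    refine abs_le_of_sq_le_sq' ?_ (by positivity) |>.2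
    refine h1.trans ?_
    rw [mul_assoc (√(2 ^ d)), mul_pow (√(2 ^ d) * _) ‖u‖, mul_pow (√(2 ^ d)),
      Real.sq_sqrt (by positivity)]
    gcongr
  · refine Eventually.of_forall fun n => ?_
    rw [ContinuousLinearMap.adjoint_comp]
    exact (hR1 n).clm_comp (ContinuousLinearMap.adjoint (H10.fnL Ω))

end Rellich

/-! ### The energy form -/

section EnergyForm

variable {d : ℕ} {Ω : Set (Space d)}

theorem Triangulation.finite_elements (T : Triangulation Ω) : T.elements.Finite := by
  refine (T.finite.image fun t : Finset (Space d) => convexHull ℝ (t : Set (Space d))).subset ?_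
  rintro τ ⟨t, ht, _, rfl⟩
  exact ⟨t, ht, rfl⟩

theorem Triangulation.iUnion_elements (T : Triangulation Ω) :
    ⋃ τ ∈ T.elements, τ = closure Ω := by
  rw [← T.space_eq]
  refine subset_antisymm (Set.iUnion₂_subset ?_) fun x hx => ?_
  · rintro τ ⟨t, ht, _, rfl⟩
    exact T.complex.convexHull_subset_space ht
  · obtain ⟨s, hs, hxs⟩ := T.complex.mem_space_iff.1 hx
    obtain ⟨t, ht, hst, hc⟩ := T.pure s hs
    exact Set.mem_iUnion₂.2 ⟨_, ⟨t, ht, hc, rfl⟩, convexHull_mono (by exact_mod_cast hst) hxs⟩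

theorem Triangulation.convex_of_mem_elements (T : Triangulation Ω) {τ : Set (Space d)}
    (hτ : τ ∈ T.elements) : Convex ℝ τ := by
  obtain ⟨t, _, _, rfl⟩ := hτ
  exact convex_convexHull ℝ _

theorem Triangulation.isCompact_of_mem_elements (T : Triangulation Ω) {τ : Set (Space d)}
    (hτ : τ ∈ T.elements) : IsCompact τ := by
  obtain ⟨t, _, _, rfl⟩ := hτ
  exact t.finite_toSet.isCompact_convexHull ℝ

/-- The coefficients are controlled only on element interiors, so these must fill `Ω` up to a null
set. They do, since the elements cover `closure Ω` and the frontier of a convex set is null. -/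
theorem Triangulation.ae_mem_interior (T : Triangulation Ω) :
    ∀ᵐ x ∂volume.restrict Ω, x ∈ ⋃ τ : T.elements, interior (τ : Set (Space d)) := by
  have : Countable T.elements := T.finite_elements.countable
  have h1 : ∀ᵐ x : Space d, ∀ τ : T.elements, x ∉ frontier (τ : Set (Space d)) := by
    rw [ae_all_iff]
    intro τ
    exact measure_eq_zero_iff_ae_notMem.1
      ((T.convex_of_mem_elements τ.2).addHaar_frontier volume)
  have h2 : ∀ᵐ x ∂volume.restrict Ω, x ∈ closure Ω :=
    ae_mono (Measure.restrict_mono_set _ subset_closure)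
      (ae_restrict_mem isClosed_closure.measurableSet)
  filter_upwards [ae_restrict_of_ae h1, h2] with x hx1 hx2
  rw [← T.iUnion_elements] at hx2
  obtain ⟨τ, hτ, hxτ⟩ := Set.mem_iUnion₂.1 hx2
  refine Set.mem_iUnion.2 ⟨⟨τ, hτ⟩, ?_⟩
  by_contra h
  exact hx1 ⟨τ, hτ⟩ ⟨subset_closure hxτ, h⟩

variable {T₀ : Triangulation Ω} {A : Space d → Matrix (Fin d) (Fin d) ℝ}

theorem IsEllipticCoefficient.aemeasurable (hA : IsEllipticCoefficient T₀ A) (k l : Fin d) :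
    AEMeasurable (fun x => A x k l) (volume.restrict Ω) := by
  have : Countable T₀.elements := T₀.finite_elements.countable
  have h1 : AEMeasurable (fun x => A x k l)
      (volume.restrict (⋃ τ : T₀.elements, interior (τ : Set (Space d)))) := by
    refine AEMeasurable.iUnion fun τ => ?_
    obtain ⟨C, hC⟩ := hA.lipschitz τ τ.2 k l
    exact hC.continuousOn.aemeasurable isOpen_interior.measurableSet
  have h2 := h1.mono_measure (Measure.restrict_mono_measure
    (Measure.restrict_le_self (μ := volume) (s := Ω)) _)
  rwa [Measure.restrict_eq_self_of_ae_mem T₀.ae_mem_interior] at h2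

theorem IsEllipticCoefficient.exists_bound (hA : IsEllipticCoefficient T₀ A) (k l : Fin d) :
    ∃ M : ℝ, ∀ᵐ x ∂volume.restrict Ω, |A x k l| ≤ M := by
  have h : ∀ τ : T₀.elements, ∃ M : ℝ, ∀ x ∈ interior (τ : Set (Space d)), |A x k l| ≤ M := by
    intro τ
    obtain ⟨C, hC⟩ := hA.lipschitz τ τ.2 k l
    have hb : Bornology.IsBounded (interior (τ : Set (Space d))) :=
      (T₀.isCompact_of_mem_elements τ.2).isBounded.subset interior_subset
    rcases (interior (τ : Set (Space d))).eq_empty_or_nonempty with h0 | ⟨y, hy⟩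
    · exact ⟨0, fun x hx => by simp [h0] at hx⟩
    · refine ⟨|A y k l| + C * Metric.diam (interior (τ : Set (Space d))), fun x hx => ?_⟩
      have h1 := hC.dist_le_mul x hx y hy
      have h2 := Metric.dist_le_diam_of_mem hb hx hy
      have h3 : |A x k l| ≤ |A y k l| + dist (A x k l) (A y k l) := by
        rw [Real.dist_eq]
        linarith [abs_sub_abs_le_abs_sub (A x k l) (A y k l)]
      have h4 : C * dist x y ≤ C * Metric.diam (interior (τ : Set (Space d))) := by gcongr
      linarith
  choose M hM using h
  have : Finite T₀.elements := T₀.finite_elements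
  obtain ⟨B, hB⟩ := (Set.finite_range M).bddAbove
  refine ⟨B, T₀.ae_mem_interior.mono fun x hx => ?_⟩
  obtain ⟨τ, hτ⟩ := Set.mem_iUnion.1 hx
  exact (hM τ x hτ).trans (hB ⟨τ, rfl⟩)

theorem inner_toEuclideanLin (B : Matrix (Fin d) (Fin d) ℝ) (ξ η : Space d) :
    inner ℝ (Matrix.toEuclideanLin B ξ) η = ∑ k, ∑ l, B k l * ξ l * η k := by
  simp [PiLp.inner_apply, Matrix.toLpLin_apply, Matrix.mulVec, dotProduct, Finset.mul_sum,
    mul_comm]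

theorem IsEllipticCoefficient.exists_norm_le (hA : IsEllipticCoefficient T₀ A) :
    ∃ M : ℝ, 0 ≤ M ∧ ∀ᵐ x ∂volume.restrict Ω, ∀ ξ η : Space d,
      ‖(inner ℝ (Matrix.toEuclideanLin (A x) ξ) η : ℝ)‖ ≤ M * (‖ξ‖ * ‖η‖) := by
  choose M hM using hA.exists_bound
  refine ⟨∑ k, ∑ l, |M k l|, Finset.sum_nonneg fun k _ => Finset.sum_nonneg fun l _ =>
    abs_nonneg _, ?_⟩
  filter_upwards [ae_all_iff.2 fun k => ae_all_iff.2 (hM k)] with x hx ξ η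
  rw [inner_toEuclideanLin, Finset.sum_mul]
  refine (norm_sum_le _ _).trans (Finset.sum_le_sum fun k _ => ?_)
  rw [Finset.sum_mul]
  refine (norm_sum_le _ _).trans (Finset.sum_le_sum fun l _ => ?_)
  rw [norm_mul, norm_mul, mul_assoc]
  have h1 := PiLp.norm_apply_le ξ l
  have h2 := PiLp.norm_apply_le η k
  have h3 : ‖A x k l‖ ≤ |M k l| := (hx k l).trans (le_abs_self _)
  gcongr

theorem integrable_norm_mul_norm (F G : L2Vec Ω) :
    Integrable (fun x => ‖F x‖ * ‖G x‖) (volume.restrict Ω) :=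
  (Lp.memLp F).norm.integrable_mul (Lp.memLp G).norm

theorem integral_norm_sq_eq (F : L2Vec Ω) : ∫ x in Ω, ‖F x‖ ^ 2 = ‖F‖ ^ 2 := by
  rw [← real_inner_self_eq_norm_sq, L2.inner_def]
  simp

theorem integral_norm_mul_norm_le (F G : L2Vec Ω) :
    ∫ x in Ω, ‖F x‖ * ‖G x‖ ≤ ‖F‖ * ‖G‖ := by
  have h := integral_mul_norm_le_Lp_mul_Lq (μ := volume.restrict Ω) Real.HolderConjugate.two_two
    (f := F) (g := G) (by simpa using Lp.memLp F) (by simpa using Lp.memLp G)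
  simpa [integral_norm_sq_eq, ← Real.sqrt_eq_rpow, Real.sqrt_sq, -one_div] using h

theorem IsEllipticCoefficient.integrable (hA : IsEllipticCoefficient T₀ A) (F G : L2Vec Ω) :
    Integrable (fun x => (inner ℝ (Matrix.toEuclideanLin (A x) (F x)) (G x) : ℝ))
      (volume.restrict Ω) := by
  obtain ⟨M, _, hM⟩ := hA.exists_norm_le
  refine ((integrable_norm_mul_norm F G).const_mul M).mono' ?_ ?_
  · simp only [inner_toEuclideanLin]
    refine AEMeasurable.aestronglyMeasurable ?_
    refine Finset.aemeasurable_fun_sum _ fun k _ => Finset.aemeasurable_fun_sum _ fun l _ => ?_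
    have h1 : AEMeasurable (fun x => F x l) (volume.restrict Ω) :=
      (EuclideanSpace.proj (𝕜 := ℝ) l).measurable.comp_aemeasurable
        (Lp.aestronglyMeasurable F).aemeasurable
    have h2 : AEMeasurable (fun x => G x k) (volume.restrict Ω) :=
      (EuclideanSpace.proj (𝕜 := ℝ) k).measurable.comp_aemeasurable
        (Lp.aestronglyMeasurable G).aemeasurable
    exact ((hA.aemeasurable k l).mul h1).mul h2
  · exact hM.mono fun x hx => hx _ _

/-- The energy form is a bounded bilinear form. -/
theorem IsEllipticCoefficient.exists_bilin (hA : IsEllipticCoefficient T₀ A) :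
    ∃ B : H10 Ω →L[ℝ] H10 Ω →L[ℝ] ℝ, ∀ u v, B u v = energyForm A u v := by
  obtain ⟨M, hM0, hM⟩ := hA.exists_norm_le
  have hadd : ∀ u v : H10 Ω, (u + v).grad = u.grad + v.grad := fun u v => rfl
  have hsmul : ∀ (c : ℝ) (u : H10 Ω), (c • u).grad = c • u.grad := fun c u => rfl
  let B₀ : H10 Ω →ₗ[ℝ] H10 Ω →ₗ[ℝ] ℝ := LinearMap.mk₂ ℝ (energyForm A)
    (fun u u' v => by
      rw [energyForm, energyForm, energyForm, ← integral_add (hA.integrable _ _) (hA.integrable _ _),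
        hadd]
      refine integral_congr_ae ?_
      filter_upwards [Lp.coeFn_add u.grad u'.grad] with x hx
      rw [hx, Pi.add_apply, map_add, inner_add_left])
    (fun c u v => by
      rw [energyForm, energyForm, hsmul, smul_eq_mul, ← integral_const_mul]
      refine integral_congr_ae ?_
      filter_upwards [Lp.coeFn_smul c u.grad] with x hx
      rw [hx, Pi.smul_apply, map_smul, real_inner_smul_left])
    (fun u v v' => by
      rw [energyForm, energyForm, energyForm, ← integral_add (hA.integrable _ _) (hA.integrable _ _),
        hadd]
      refine integral_congr_ae ?_
      filter_upwards [Lp.coeFn_add v.grad v'.grad] with x hx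
      rw [hx, Pi.add_apply, inner_add_right])
    (fun c u v => by
      rw [energyForm, energyForm, hsmul, smul_eq_mul, ← integral_const_mul]
      refine integral_congr_ae ?_
      filter_upwards [Lp.coeFn_smul c v.grad] with x hx
      rw [hx, Pi.smul_apply, real_inner_smul_right])
  refine ⟨B₀.mkContinuous₂ M fun u v => ?_, fun u v => rfl⟩
  calc ‖B₀ u v‖ ≤ ∫ x in Ω, M * (‖u.grad x‖ * ‖v.grad x‖) :=
        norm_integral_le_of_norm_le ((integrable_norm_mul_norm _ _).const_mul M)
          (hM.mono fun x hx => hx _ _)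
    _ ≤ M * (‖u.grad‖ * ‖v.grad‖) := by
        rw [integral_const_mul]
        gcongr
        exact integral_norm_mul_norm_le _ _
    _ ≤ M * ‖u‖ * ‖v‖ := by
        rw [mul_assoc]
        gcongr
        exacts [H10.norm_grad_le u, H10.norm_grad_le v]

theorem IsEllipticCoefficient.energyForm_comm (hA : IsEllipticCoefficient T₀ A)
    (hΩ : MeasurableSet Ω) (u v : H10 Ω) : energyForm A u v = energyForm A v u := by
  refine integral_congr_ae ?_
  filter_upwards [ae_restrict_mem hΩ] with x hx
  rw [inner_toEuclideanLin, inner_toEuclideanLin, Finset.sum_comm]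
  refine Finset.sum_congr rfl fun k _ => Finset.sum_congr rfl fun l _ => ?_
  rw [(hA.symm x hx).apply l k]
  ring

/-- The energy form is coercive on a bounded open set. -/
theorem IsEllipticCoefficient.exists_coercive (hA : IsEllipticCoefficient T₀ A) (hd : 0 < d)
    (hΩ : IsOpen Ω) (hb : Bornology.IsBounded Ω) :
    ∃ c : ℝ, 0 < c ∧ ∀ u : H10 Ω, c * ‖u‖ ^ 2 ≤ energyForm A u u := by
  obtain ⟨α, hα, hell⟩ := hA.elliptic
  obtain ⟨C, hC0, hC⟩ := exists_poincare hd hΩ hb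
  refine ⟨α / (C ^ 2 + 1), by positivity, fun u => ?_⟩
  have h1 : α * ‖u.grad‖ ^ 2 ≤ energyForm A u u := by
    rw [← integral_norm_sq_eq, ← integral_const_mul]
    refine integral_mono_ae ?_ (hA.integrable _ _) ?_
    · simpa [sq] using (integrable_norm_mul_norm u.grad u.grad).const_mul α
    · filter_upwards [ae_restrict_mem hΩ.measurableSet] with x hx using hell x hx _
  have h2 : ‖u‖ ^ 2 ≤ (C ^ 2 + 1) * ‖u.grad‖ ^ 2 := by
    have h3 := H10.norm_sq u
    have h4 : ‖u.fn‖ ^ 2 ≤ (C * ‖u.grad‖) ^ 2 := by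
      have := hC u
      gcongr
    nlinarith
  refine le_trans ?_ h1
  rw [div_mul_eq_mul_div, div_le_iff₀ (by positivity)]
  nlinarith

end EnergyForm

/-! ### Lipschitz functions with compact support belong to `H¹₀` -/

section LipschitzFunctions

variable {d : ℕ} {Ω : Set (Space d)}

/-- If the images of a bounded sequence under a bounded operator between Hilbert spaces converge,
then the limit is the image of a point satisfying the same bound. -/
theorem exists_norm_le_of_tendsto_map {H E : Type*} [NormedAddCommGroup H] [InnerProductSpace ℝ H]
    [CompleteSpace H] [NormedAddCommGroup E] [InnerProductSpace ℝ E] [CompleteSpace E]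
    (J : H →L[ℝ] E) {x : ℕ → H} {r : ℝ} (hx : ∀ n, ‖x n‖ ≤ r) {f : E}
    (hf : Tendsto (fun n => J (x n)) atTop (𝓝 f)) : ∃ v : H, ‖v‖ ≤ r ∧ J v = f := by
  -- Banach–Alaoglu, with `H` identified with its dual. Along an ultrafilter the bounded sequence
  -- converges weakly without extraction of a subsequence. The limit is identified by testing
  -- against `J* y`.
  let U : Ultrafilter ℕ := Ultrafilter.of atTop
  have hU : (U : Filter ℕ) ≤ atTop := Ultrafilter.of_le _
  let X : ℕ → WeakDual ℝ H := fun n => StrongDual.toWeakDual (InnerProductSpace.toDual ℝ H (x n))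
  have hc := WeakDual.isCompact_closedBall (𝕜 := ℝ) (0 : StrongDual ℝ H) r
  obtain ⟨Y, hY, hlim⟩ := hc.ultrafilter_le_nhds' (U.map X)
    (Ultrafilter.mem_map.2 (Eventually.of_forall fun n => by
      simpa [X] using hx n))
  let v : H := (InnerProductSpace.toDual ℝ H).symm (WeakDual.toStrongDual Y)
  have hv : ∀ y, inner ℝ v y = Y y := fun y => by
    simp [v]
  have hXlim : ∀ y, Tendsto (fun n => inner ℝ (x n) y) U (𝓝 (inner ℝ v y)) := by
    intro y
    rw [hv]
    have h1 : Tendsto X U (𝓝 Y) := hlim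
    have h2 := ((WeakDual.eval_continuous y).tendsto Y).comp h1
    refine h2.congr fun n => ?_
    simp [X]
  refine ⟨v, by simpa [v] using hY, ext_inner_right ℝ fun y => ?_⟩
  have h3 := hXlim (ContinuousLinearMap.adjoint J y)
  simp only [ContinuousLinearMap.adjoint_inner_right] at h3
  have h4 : Tendsto (fun n => (inner ℝ (J (x n)) y : ℝ)) U (𝓝 (inner ℝ f y)) :=
    (hf.inner tendsto_const_nhds).mono_left hU
  exact tendsto_nhds_unique h3 h4

theorem norm_gradient (φ : Space d → ℝ) (x : Space d) : ‖gradient φ x‖ = ‖fderiv ℝ φ x‖ := by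
  simp [gradient]

/-- Every test function defines an element of `H¹₀`. -/
theorem exists_H10_of_test {φ : Space d → ℝ} (h1 : ContDiff ℝ ∞ φ) (h2 : HasCompactSupport φ)
    (h3 : tsupport φ ⊆ Ω) :
    ∃ u : H10 Ω, u.fn =ᵐ[volume.restrict Ω] φ ∧ u.grad =ᵐ[volume.restrict Ω] gradient φ := by
  have m1 : MemLp φ 2 (volume.restrict Ω) :=
    (h1.continuous.memLp_of_hasCompactSupport h2).restrict Ω
  have hgs : HasCompactSupport (gradient φ) := by
    refine (h2.fderiv ℝ).comp_left (g := (InnerProductSpace.toDual ℝ (Space d)).symm) (by simp)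
  have m2 : MemLp (gradient φ) 2 (volume.restrict Ω) :=
    ((continuous_gradient_of_contDiff h1).memLp_of_hasCompactSupport hgs).restrict Ω
  refine ⟨⟨WithLp.toLp 2 (m1.toLp φ, m2.toLp (gradient φ)),
    (testPairs Ω).le_topologicalClosure ⟨φ, h1, h2, h3, m1.coeFn_toLp, m2.coeFn_toLp⟩⟩, ?_, ?_⟩
  · exact m1.coeFn_toLp
  · exact m2.coeFn_toLp

/-- The norm of a Lipschitz test function is controlled by its Lipschitz constant. -/
theorem exists_norm_le_of_lipschitz_test (hd : 0 < d) (hΩ : IsOpen Ω)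
    (hb : Bornology.IsBounded Ω) :
    ∃ C : ℝ, 0 ≤ C ∧ ∀ (u : H10 Ω) (φ : Space d → ℝ) (L : NNReal), LipschitzWith L φ →
      u.grad =ᵐ[volume.restrict Ω] gradient φ → ‖u‖ ≤ C * L := by
  obtain ⟨C, hC0, hC⟩ := exists_poincare hd hΩ hb
  have : IsFiniteMeasure (volume.restrict Ω) := ⟨by
    rw [Measure.restrict_apply_univ]; exact hb.measure_lt_top⟩
  set m : ℝ := (measureUnivNNReal (volume.restrict Ω) : ℝ) ^ (2 : ENNReal).toReal⁻¹ with hm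
  refine ⟨(C + 1) * m, by positivity, fun u φ L hφ hu => ?_⟩
  have h1 : ‖u.grad‖ ≤ m * L := by
    refine Lp.norm_le_of_ae_bound L.2 ?_
    filter_upwards [hu] with x hx
    rw [hx, norm_gradient]
    exact norm_fderiv_le_of_lipschitz ℝ hφ
  have h2 : ‖u‖ ≤ ‖u.fn‖ + ‖u.grad‖ := by
    refine abs_le_of_sq_le_sq' ?_ (by positivity) |>.2
    rw [H10.norm_sq]
    nlinarith [norm_nonneg u.fn, norm_nonneg u.grad]
  calc ‖u‖ ≤ C * ‖u.grad‖ + ‖u.grad‖ := h2.trans (by linarith [hC u])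
    _ = (C + 1) * ‖u.grad‖ := by ring
    _ ≤ (C + 1) * (m * L) := by gcongr
    _ = (C + 1) * m * L := by ring

/-- Smooth approximation of a compactly supported Lipschitz function, with the same Lipschitz
constant. -/
theorem exists_test_approx (hΩ : IsOpen Ω) {f : Space d → ℝ} {L : NNReal} (hf : LipschitzWith L f)
    (hc : HasCompactSupport f) (hs : tsupport f ⊆ Ω) {ε : ℝ} (hε : 0 < ε) :
    ∃ φ : Space d → ℝ, ContDiff ℝ ∞ φ ∧ HasCompactSupport φ ∧ tsupport φ ⊆ Ω ∧
      LipschitzWith L φ ∧ ∀ x, |φ x - f x| ≤ L * ε := by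
  obtain ⟨δ, hδ, hδΩ⟩ := hc.isCompact.exists_cthickening_subset_open hΩ hs
  -- The radius is at most `δ` to keep the support inside `Ω`, and at most `ε` to control the error.
  -- Averaging against a probability density preserves the Lipschitz constant.
  let ρ : ContDiffBump (0 : Space d) :=
    ⟨min δ ε / 2, min δ ε, by positivity, half_lt_self (by positivity)⟩
  have hsupp : Function.support (ρ.normed volume) = Metric.ball 0 (min δ ε) := ρ.support_normed_eq
  have hloc : LocallyIntegrable f (volume : Measure (Space d)) :=
    hf.continuous.locallyIntegrable
  have hexists : ∀ x, ConvolutionExistsAt (ρ.normed volume) f x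
      (ContinuousLinearMap.lsmul ℝ ℝ) volume := fun x =>
    ρ.hasCompactSupport_normed.convolutionExists_left _ ρ.continuous_normed hloc x
  have hsub : Function.support (convolution (ρ.normed volume) f
      (ContinuousLinearMap.lsmul ℝ ℝ) volume) ⊆ Metric.cthickening δ (tsupport f) := by
    refine (support_convolution_subset _).trans ?_
    rintro _ ⟨a, ha, b, hb, rfl⟩
    rw [hsupp, mem_ball_zero_iff] at ha
    refine Metric.mem_cthickening_of_dist_le (a + b) b δ _ (subset_tsupport f hb) ?_
    simpa using (ha.trans_le (min_le_left _ _)).le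
  refine ⟨convolution (ρ.normed volume) f (ContinuousLinearMap.lsmul ℝ ℝ) volume, ?_, ?_, ?_, ?_, ?_⟩
  · exact ρ.hasCompactSupport_normed.contDiff_convolution_left _ ρ.contDiff_normed hloc
  · exact ρ.hasCompactSupport_normed.convolution _ hc
  · exact (closure_minimal hsub Metric.isClosed_cthickening).trans hδΩ
  · refine LipschitzWith.of_dist_le_mul fun x y => ?_
    rw [convolution_def, convolution_def, dist_eq_norm, ← integral_sub (hexists x) (hexists y)]
    calc ‖∫ t, (ContinuousLinearMap.lsmul ℝ ℝ (ρ.normed volume t) (f (x - t)) -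
            ContinuousLinearMap.lsmul ℝ ℝ (ρ.normed volume t) (f (y - t)))‖
        ≤ ∫ t, ρ.normed volume t * (L * dist x y) := by
          refine norm_integral_le_of_norm_le (ρ.integrable_normed.mul_const _)
            (Eventually.of_forall fun t => ?_)
          rw [← map_sub, ContinuousLinearMap.lsmul_apply, norm_smul,
            Real.norm_of_nonneg (ρ.nonneg_normed t)]
          gcongr
          · exact ρ.nonneg_normed t
          · simpa [dist_eq_norm] using hf.dist_le_mul (x - t) (y - t)
      _ = L * dist x y := by rw [integral_mul_const, ρ.integral_normed, one_mul]
  · intro x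
    rw [← Real.dist_eq]
    refine ρ.dist_normed_convolution_le hf.continuous.aestronglyMeasurable fun y hy => ?_
    refine (hf.dist_le_mul y x).trans ?_
    gcongr
    exact (Metric.mem_ball.1 hy).le.trans (min_le_right _ _)

/-- A compactly supported Lipschitz function belongs to `H¹₀`, with norm controlled by the Lipschitz
constant. -/
theorem exists_H10_of_lipschitz (hd : 0 < d) (hΩ : IsOpen Ω) (hb : Bornology.IsBounded Ω) :
    ∃ C : ℝ, 0 ≤ C ∧ ∀ (f : Space d → ℝ) (L : NNReal), LipschitzWith L f → HasCompactSupport f →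
      tsupport f ⊆ Ω → ∃ v : H10 Ω, v.fn =ᵐ[volume.restrict Ω] f ∧ ‖v‖ ≤ C * L := by
  obtain ⟨C, hC0, hC⟩ := exists_norm_le_of_lipschitz_test hd hΩ hb
  refine ⟨C, hC0, fun f L hf hc hs => ?_⟩
  have : IsFiniteMeasure (volume.restrict Ω) := ⟨by
    rw [Measure.restrict_apply_univ]; exact hb.measure_lt_top⟩
  have hfL : MemLp f 2 (volume.restrict Ω) :=
    (hf.continuous.memLp_of_hasCompactSupport hc).restrict Ω
  choose φ h1 h2 h3 h4 h5 using fun n : ℕ =>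
    exists_test_approx hΩ hf hc hs (ε := 1 / ((n : ℝ) + 1)) (by positivity)
  choose u hu1 hu2 using fun n => exists_H10_of_test (h1 n) (h2 n) (h3 n)
  set m : ℝ := (measureUnivNNReal (volume.restrict Ω) : ℝ) ^ (2 : ENNReal).toReal⁻¹ with hm
  have hlim : Tendsto (fun n => H10.fnL Ω (u n)) atTop (𝓝 (hfL.toLp f)) := by
    rw [tendsto_iff_norm_sub_tendsto_zero]
    have hl : Tendsto (fun n : ℕ => m * (L * (1 / ((n : ℝ) + 1)))) atTop (𝓝 0) := by
      simpa using (tendsto_one_div_add_atTop_nhds_zero_nat.const_mul (L : ℝ)).const_mul m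
    refine squeeze_zero (fun n => by positivity) (fun n => ?_) hl
    refine Lp.norm_le_of_ae_bound (by positivity) ?_
    filter_upwards [Lp.coeFn_sub (u n).fn (hfL.toLp f), hu1 n, hfL.coeFn_toLp] with x k1 k2 k3
    rw [H10.fnL_apply, k1, Pi.sub_apply, k2, k3]
    exact h5 n x
  -- The mollifications converge in `L²` while their `H¹` norms merely stay bounded. A weak limit
  -- suffices, and `f` need not be differentiated.
  obtain ⟨v, hv1, hv2⟩ := exists_norm_le_of_tendsto_map (H10.fnL Ω)
    (fun n => hC (u n) (φ n) L (h4 n) (hu2 n)) hlim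
  refine ⟨v, ?_, hv1⟩
  rw [H10.fnL_apply] at hv2
  rw [hv2]
  exact hfL.coeFn_toLp

end LipschitzFunctions

/-! ### Density of the finite element spaces -/

section Interpolation

variable {d : ℕ} {Ω : Set (Space d)}

/-- A continuous function which is `L`-Lipschitz on each of finitely many closed sets, and vanishes
off their union, is `L`-Lipschitz. -/
theorem lipschitzWith_of_finite_closed_cover {E : Type*} [NormedAddCommGroup E] [NormedSpace ℝ E]
    {f : E → ℝ} (hf : Continuous f) {S : Set (Set E)} (hS : S.Finite) (hcl : ∀ τ ∈ S, IsClosed τ)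
    {L : NNReal} (hL : ∀ τ ∈ S, ∀ x ∈ τ, ∀ y ∈ τ, |f x - f y| ≤ L * ‖x - y‖)
    (h0 : ∀ x, (∀ τ ∈ S, x ∉ τ) → f x = 0) : LipschitzWith L f := by
  refine LipschitzWith.of_dist_le_mul fun y x => ?_
  let p : ℝ → E := fun t => x + t • (y - x)
  have hp : Continuous p := by fun_prop
  have hpd : ∀ s t, ‖p s - p t‖ = |s - t| * ‖y - x‖ := fun s t => by
    simp only [p, add_sub_add_left_eq_sub, ← sub_smul, norm_smul, Real.norm_eq_abs]
  let F : ℝ → ℝ := fun t => ‖f (p t) - f x‖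
  have hF : Continuous F := by fun_prop
  -- Either some closed set is met at times arbitrarily close to the right of `t`, and then it
  -- contains `p t`, or the function vanishes just after `t`. A bound for frequently many `z` is all
  -- that the mean value inequality with lower right slopes requires.
  have hfreq : ∀ t : ℝ, ∃ᶠ z in 𝓝[>] t, |f (p z) - f (p t)| ≤ L * ‖y - x‖ * (z - t) := by
    intro t
    by_cases h : ∃ τ ∈ S, ∃ᶠ z in 𝓝[>] t, p z ∈ τ
    · obtain ⟨τ, hτ, hfr⟩ := h
      have hpt : p t ∈ τ := by
        have h1 : ∃ᶠ z in 𝓝 t, p z ∈ τ := hfr.filter_mono nhdsWithin_le_nhds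
        exact ((hcl τ hτ).preimage hp).mem_of_frequently_of_tendsto h1 tendsto_id
      refine (hfr.and_eventually self_mem_nhdsWithin).mono fun z hz => ?_
      have h2 := hL τ hτ _ hz.1 _ hpt
      rw [hpd, abs_of_pos (sub_pos.2 hz.2)] at h2
      linarith
    · push Not at h
      have h1 : ∀ᶠ z in 𝓝[>] t, ∀ τ ∈ S, p z ∉ τ := (hS.eventually_all).2 h
      have h2 : ∀ᶠ z in 𝓝[>] t, f (p z) = 0 := h1.mono fun z hz => h0 _ hz
      have h3 : f (p t) = 0 :=
        tendsto_nhds_unique_of_eventuallyEq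
          ((hf.comp hp).continuousAt.tendsto.mono_left nhdsWithin_le_nhds) tendsto_const_nhds h2
      refine (h2.and self_mem_nhdsWithin).frequently.mono fun z hz => ?_
      have : t < z := hz.2
      rw [hz.1, h3, sub_zero, abs_zero]
      have := sub_pos.2 this
      positivity
  have main := image_le_of_liminf_slope_right_le_deriv_boundary (f := F) (a := 0) (b := 1)
    (B := fun t => L * ‖y - x‖ * t) (B' := fun _ => L * ‖y - x‖) hF.continuousOn
    (by simp [F, p]) (by fun_prop)
    (fun t _ => by simpa using ((hasDerivAt_id t).const_mul (L * ‖y - x‖)).hasDerivWithinAt)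
    (fun t _ r hr => by
      refine ((hfreq t).and_eventually self_mem_nhdsWithin).mono fun z hz => ?_
      have hzt : 0 < z - t := sub_pos.2 hz.2
      rw [slope_def_field, div_lt_iff₀ hzt]
      have h1 : F z - F t ≤ |f (p z) - f (p t)| := by
        have := norm_sub_norm_le (f (p z) - f x) (f (p t) - f x)
        simpa [F] using this
      nlinarith [hz.1])
    (x := 1) (by simp)
  simpa [F, p, dist_eq_norm] using main

/-- Interpolation of arbitrary values at the vertices of a nondegenerate simplex. -/
theorem exists_affine_interpolation {t : Finset (Space d)}
    (hi : AffineIndependent ℝ ((↑) : t → Space d)) (hc : t.card = d + 1) (φ : Space d → ℝ) :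
    ∃ (c : ℝ) (G : Space d), ∀ v ∈ t, φ v = c + inner ℝ G v := by
  have htop : affineSpan ℝ (Set.range ((↑) : t → Space d)) = ⊤ := by
    rw [hi.affineSpan_eq_top_iff_card_eq_finrank_add_one]
    simp [hc]
  let b : AffineBasis t ℝ (Space d) := ⟨(↑), hi, htop⟩
  let g : Space d →ᵃ[ℝ] ℝ := ∑ i : t, φ i • b.coord i
  have hg : ∀ v : t, g v = φ v := by
    intro v
    have h1 : ∀ i : t, b.coord i (v : Space d) = if i = v then 1 else 0 := fun i =>
      b.coord_apply i v
    have h2 : g v = ∑ i : t, φ i * b.coord i (v : Space d) := by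
      simp only [g]
      induction (Finset.univ : Finset t) using Finset.induction with
      | empty => simp
      | insert a s ha ih => rw [Finset.sum_insert ha, Finset.sum_insert ha, ← ih]; simp
    rw [h2]
    simp [h1]
  refine ⟨g 0, (InnerProductSpace.toDual ℝ (Space d)).symm
    (LinearMap.toContinuousLinearMap g.linear), fun v hv => ?_⟩
  rw [← hg ⟨v, hv⟩]
  have h3 := congrFun g.decomp v
  simp only [Pi.add_apply] at h3
  simpa [add_comm] using h3

theorem isPolyOn_affine {n : ℕ} (hn : 1 ≤ n) {τ : Set (Space d)} {g : Space d → ℝ} {c : ℝ}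
    {G : Space d} (hg : ∀ x ∈ τ, g x = c + inner ℝ G x) : IsPolyOn n τ g := by
  refine ⟨MvPolynomial.C c + ∑ k, MvPolynomial.C (G k) * MvPolynomial.X k, ?_, fun x hx => ?_⟩
  · refine (MvPolynomial.totalDegree_add _ _).trans (max_le (by simp) ?_)
    refine MvPolynomial.totalDegree_finsetSum_le fun k _ => ?_
    refine (MvPolynomial.totalDegree_mul _ _).trans ?_
    simpa using hn
  · rw [hg x hx]
    simp [PiLp.inner_apply, mul_comm]

/-- A linear functional which oscillates by at most `e` on a set containing a ball of diameter `δ`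
has norm at most `e / δ`. -/
theorem abs_apply_mul_le_of_closedBall_subset {τ : Set (Space d)} {q : Space d →L[ℝ] ℝ} {e : ℝ}
    (hq : ∀ x ∈ τ, ∀ y ∈ τ, |q x - q y| ≤ e) {x : Space d} {r : ℝ} (hr : 0 ≤ r)
    (hx : Metric.closedBall x r ⊆ τ) (ξ : Space d) : |q ξ| * (2 * r) ≤ e * ‖ξ‖ := by
  rcases eq_or_ne ξ 0 with rfl | hξ
  · simp
  have hξ' : 0 < ‖ξ‖ := norm_pos_iff.2 hξ
  have hn : ‖(r / ‖ξ‖) • ξ‖ = r := by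
    rw [norm_smul, Real.norm_of_nonneg (by positivity)]
    field_simp
  have h1 := hq (x + (r / ‖ξ‖) • ξ) (hx (by simp [hn])) (x - (r / ‖ξ‖) • ξ)
    (hx (by simp [hn]))
  have h2 : q (x + (r / ‖ξ‖) • ξ) - q (x - (r / ‖ξ‖) • ξ) = 2 * r / ‖ξ‖ * q ξ := by
    rw [map_add, map_sub, map_smul, smul_eq_mul]; ring
  rw [h2, abs_mul, abs_of_nonneg (by positivity)] at h1
  rw [div_mul_eq_mul_div, div_le_iff₀ hξ'] at h1
  linarith

theorem opNorm_mul_inDiam_le {τ : Set (Space d)} {q : Space d →L[ℝ] ℝ} {e : ℝ}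
    (hq : ∀ x ∈ τ, ∀ y ∈ τ, |q x - q y| ≤ e) (hne : τ.Nonempty) (ξ : Space d) :
    |q ξ| * inDiam τ ≤ e * ‖ξ‖ := by
  have he : 0 ≤ e := by
    obtain ⟨x, hx⟩ := hne
    exact (abs_nonneg _).trans (hq x hx x hx)
  rcases eq_or_ne (q ξ) 0 with h0 | h0
  · rw [h0, abs_zero, zero_mul]; positivity
  have h0' : 0 < |q ξ| := abs_pos.2 h0
  rw [← le_div_iff₀' h0']
  refine csSup_le ?_ ?_
  · obtain ⟨x, hx⟩ := hne
    exact ⟨0, x, 0, le_rfl, by simpa using hx, by simp⟩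
  · rintro δ ⟨x, r, hr, hx, rfl⟩
    rw [le_div_iff₀' h0']
    exact abs_apply_mul_le_of_closedBall_subset hq hr hx ξ

/-- The oscillation of a linear functional is governed by the vertices, since half-spaces are
convex. The argument is applied to one variable at a time. -/
theorem abs_sub_le_on_convexHull {t : Set (Space d)} {q : Space d →L[ℝ] ℝ} {e : ℝ}
    (hq : ∀ v ∈ t, ∀ w ∈ t, |q v - q w| ≤ e) :
    ∀ x ∈ convexHull ℝ t, ∀ y ∈ convexHull ℝ t, |q x - q y| ≤ e := by
  have hlin : IsLinearMap ℝ (q : Space d → ℝ) := q.toLinearMap.isLinear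
  have h1 : ∀ w ∈ t, ∀ x ∈ convexHull ℝ t, q x ≤ q w + e := fun w hw x hx =>
    convexHull_min (t := {x | q x ≤ q w + e}) (fun v hv => by
      have := (abs_le.1 (hq v hv w hw)).2
      simp only [Set.mem_ofPred_eq]; linarith) (convex_halfSpace_le hlin _) hx
  have h2 : ∀ x ∈ convexHull ℝ t, ∀ y ∈ convexHull ℝ t, q x - e ≤ q y := fun x hx y hy =>
    convexHull_min (t := {y | q x - e ≤ q y}) (fun w hw => by
      have := h1 w hw x hx
      simp only [Set.mem_ofPred_eq]; linarith) (convex_halfSpace_ge hlin _) hy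
  intro x hx y hy
  rw [abs_le]
  constructor <;> linarith [h2 x hx y hy, h2 y hy x hx]

/-- Division by `0` yields `0`, so `h_τ / ρ_τ ≤ γ` carries information only once `ρ_τ > 0` is known.
As a real `sSup` of an unbounded set is `0`, an upper bound on inscribed balls is needed too. It
comes from the oscillation of a coordinate functional. -/
theorem inDiam_pos {t : Finset (Space d)} (hd : 0 < d)
    (hi : AffineIndependent ℝ ((↑) : t → Space d)) (hc : t.card = d + 1) :
    0 < inDiam (convexHull ℝ (t : Set (Space d))) := by
  set τ := convexHull ℝ (t : Set (Space d)) with hτ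
  have htop : affineSpan ℝ (t : Set (Space d)) = ⊤ := by
    have := (hi.affineSpan_eq_top_iff_card_eq_finrank_add_one).2 (by simp [hc])
    simpa using this
  obtain ⟨x, hx⟩ := interior_convexHull_nonempty_iff_affineSpan_eq_top.2 htop
  obtain ⟨r, hr, hxr⟩ := Metric.nhds_basis_closedBall.mem_iff.1 (mem_interior_iff_mem_nhds.1 hx)
  have hbdd : Bornology.IsBounded τ := (t.finite_toSet.isCompact_convexHull ℝ).isBounded
  let ξ : Space d := EuclideanSpace.single ⟨0, hd⟩ 1
  have hξ : ‖ξ‖ = 1 := by simp [ξ]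
  have hq : ∀ x ∈ τ, ∀ y ∈ τ, |innerSL ℝ ξ x - innerSL ℝ ξ y| ≤ Metric.diam τ := by
    intro x hx y hy
    rw [← map_sub]
    refine (norm_inner_le_norm (𝕜 := ℝ) ξ (x - y)).trans ?_
    rw [hξ, one_mul, ← dist_eq_norm]
    exact Metric.dist_le_diam_of_mem hbdd hx hy
  have hB : BddAbove {δ | ∃ (x : Space d) (r : ℝ), 0 ≤ r ∧ Metric.closedBall x r ⊆ τ ∧
      δ = 2 * r} := by
    refine ⟨Metric.diam τ, ?_⟩
    rintro δ ⟨y, s, hs, hys, rfl⟩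
    have := abs_apply_mul_le_of_closedBall_subset hq hs hys ξ
    simpa [hξ] using this
  have := le_csSup hB ⟨x, r, hr.le, hxr, rfl⟩
  exact lt_of_lt_of_le (by positivity) this

/-- Error estimate for the linear interpolation of a smooth function on a simplex. -/
theorem abs_interpolation_error_sub_le {t : Finset (Space d)} (hd : 0 < d)
    (hi : AffineIndependent ℝ ((↑) : t → Space d)) (hc : t.card = d + 1) {φ : Space d → ℝ}
    (hφ : Differentiable ℝ φ) {D : NNReal} (hD : LipschitzWith D (fderiv ℝ φ)) {c : ℝ}
    {G : Space d} (hG : ∀ v ∈ t, φ v = c + inner ℝ G v) {γ : ℝ}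
    (hγ : Metric.diam (convexHull ℝ (t : Set (Space d))) /
      inDiam (convexHull ℝ (t : Set (Space d))) ≤ γ) :
    ∀ x ∈ convexHull ℝ (t : Set (Space d)), ∀ y ∈ convexHull ℝ (t : Set (Space d)),
      |(φ x - (c + inner ℝ G x)) - (φ y - (c + inner ℝ G y))| ≤
        D * Metric.diam (convexHull ℝ (t : Set (Space d))) * (1 + γ) * ‖x - y‖ := by
  set τ := convexHull ℝ (t : Set (Space d)) with hτ
  set h := Metric.diam τ with hh
  have hbdd : Bornology.IsBounded τ := (t.finite_toSet.isCompact_convexHull ℝ).isBounded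
  have hconv : Convex ℝ τ := convex_convexHull ℝ _
  have hpos := inDiam_pos hd hi hc
  rw [← hτ] at hpos
  obtain ⟨v₀, hv₀⟩ : t.Nonempty := Finset.card_pos.1 (by omega)
  have hsub : (t : Set (Space d)) ⊆ τ := subset_convexHull ℝ _
  have h1 : ∀ x ∈ τ, ∀ y ∈ τ,
      |φ x - φ y - fderiv ℝ φ v₀ (x - y)| ≤ D * h * ‖x - y‖ := by
    intro x hx y hy
    refine hconv.norm_image_sub_le_of_norm_fderiv_le' (𝕜 := ℝ) (fun z _ => hφ z)
      (fun z hz => ?_) hy hx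
    rw [← dist_eq_norm]
    refine (hD.dist_le_mul _ _).trans ?_
    gcongr
    exact Metric.dist_le_diam_of_mem hbdd hz (hsub hv₀)
  -- The gap between the gradient of the interpolant and the derivative of `φ` at a vertex. Both
  -- functions agree at the vertices, so `q` oscillates there by at most `D h²`. Division by `ρ_τ`
  -- turns this into the bound `D h γ`.
  let q : Space d →L[ℝ] ℝ := innerSL ℝ G - fderiv ℝ φ v₀
  have hqv : ∀ v ∈ (t : Set (Space d)), ∀ w ∈ (t : Set (Space d)),
      |q v - q w| ≤ D * h * h := by
    intro v hv w hw
    have h2 := h1 v (hsub hv) w (hsub hw)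
    rw [hG v hv, hG w hw, map_sub] at h2
    have h3 : ‖v - w‖ ≤ h := by
      rw [← dist_eq_norm]; exact Metric.dist_le_diam_of_mem hbdd (hsub hv) (hsub hw)
    have h4 : q v - q w = c + inner ℝ G v - (c + inner ℝ G w) -
        (fderiv ℝ φ v₀ v - fderiv ℝ φ v₀ w) := by
      simp only [q, sub_apply, innerSL_apply_apply]; ring
    rw [h4]
    refine h2.trans ?_
    have : 0 ≤ h := Metric.diam_nonneg
    gcongr
  have hq := abs_sub_le_on_convexHull hqv
  intro x hx y hy
  have h5 := opNorm_mul_inDiam_le hq ⟨v₀, hsub hv₀⟩ (x - y)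
  rw [← hτ] at h5
  have h6 : |q (x - y)| ≤ D * h * γ * ‖x - y‖ := by
    rw [← le_div_iff₀ hpos] at h5
    refine h5.trans ?_
    rw [show D * h * h * ‖x - y‖ / inDiam τ = D * h * (h / inDiam τ) * ‖x - y‖ by ring]
    have : 0 ≤ h := Metric.diam_nonneg
    gcongr
  have h7 := h1 x hx y hy
  have h8 : φ x - (c + inner ℝ G x) - (φ y - (c + inner ℝ G y)) =
      (φ x - φ y - fderiv ℝ φ v₀ (x - y)) - q (x - y) := by
    simp only [q, sub_apply, innerSL_apply_apply, inner_sub_right]; ring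
  rw [h8]
  refine (abs_sub _ _).trans ?_
  linarith

end Interpolation

/-! ### Global piecewise linear interpolants and their approximation property in `H¹₀`. -/

section Density

variable {d : ℕ} {Ω : Set (Space d)}

theorem Triangulation.diam_le_meshSize (T : Triangulation Ω) {τ : Set (Space d)}
    (hτ : τ ∈ T.elements) : Metric.diam τ ≤ T.meshSize :=
  le_csSup (T.finite_elements.image _).bddAbove ⟨τ, hτ, rfl⟩

theorem Triangulation.meshSize_pos (T : Triangulation Ω) (hd : 0 < d) (hne : Ω.Nonempty) :
    0 < T.meshSize := by
  obtain ⟨x, hx⟩ := hne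
  have h1 := subset_closure hx
  rw [← T.iUnion_elements] at h1
  obtain ⟨τ, hτ, _⟩ := Set.mem_iUnion₂.1 h1
  refine lt_of_lt_of_le ?_ (T.diam_le_meshSize hτ)
  obtain ⟨t, _, hc, rfl⟩ := id hτ
  obtain ⟨v, hv, w, hw, hvw⟩ := Finset.one_lt_card.1 (by omega : 1 < t.card)
  have hsub := subset_convexHull ℝ (t : Set (Space d))
  exact (dist_pos.2 hvw).trans_le (Metric.dist_le_diam_of_mem
    (T.isCompact_of_mem_elements hτ).isBounded (hsub hv) (hsub hw))

/-- The nodal piecewise linear interpolant of a test function whose support keeps a distance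
greater than the mesh size from the boundary. -/
theorem Triangulation.exists_interpolant (T : Triangulation Ω) (hd : 0 < d) (hΩ : IsOpen Ω)
    {n : ℕ} (hn : 1 ≤ n) {φ : Space d → ℝ} (h1 : ContDiff ℝ ∞ φ) (h2 : HasCompactSupport φ)
    {D : NNReal} (hD : LipschitzWith D (fderiv ℝ φ)) {γ : ℝ} (hγ0 : 0 ≤ γ)
    (hγ : ∀ τ ∈ T.elements, Metric.diam τ / inDiam τ ≤ γ) {h : ℝ} (hh : T.meshSize ≤ h)
    (hs : Metric.cthickening h (tsupport φ) ⊆ Ω) :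
    ∃ g : Space d → ℝ, Continuous g ∧ HasCompactSupport g ∧ tsupport g ⊆ Ω ∧
      (∀ τ ∈ T.elements, IsPolyOn n τ g) ∧
      LipschitzWith (D * h * (1 + γ)).toNNReal (φ - g) := by
  classical
  let S : Set (Finset (Space d)) := {t | t ∈ T.complex.faces ∧ t.card = d + 1}
  have hSel : ∀ t ∈ S, convexHull ℝ (t : Set (Space d)) ∈ T.elements :=
    fun t ht => ⟨t, ht.1, ht.2, rfl⟩
  have hex : ∀ t : Finset (Space d), ∃ p : ℝ × Space d, t ∈ S →
      ∀ v ∈ t, φ v = p.1 + inner ℝ p.2 v := by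
    intro t
    by_cases ht : t ∈ S
    · obtain ⟨c, G, hG⟩ := exists_affine_interpolation (T.complex.indep ht.1) ht.2 φ
      exact ⟨(c, G), fun _ => hG⟩
    · exact ⟨0, fun h => absurd h ht⟩
  choose p hp using hex
  -- By conformity two elements meet in the hull of their common vertices, where both affine
  -- functions interpolate `φ`. The choice of element in the definition of `g` is thus immaterial.
  have hcons : ∀ s ∈ S, ∀ t ∈ S, ∀ x ∈ convexHull ℝ (s : Set (Space d)),
      x ∈ convexHull ℝ (t : Set (Space d)) →
      (p s).1 + inner ℝ (p s).2 x = (p t).1 + inner ℝ (p t).2 x := by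
    intro s hs t ht x hxs hxt
    refine convexHull_min
      (t := {x | (p s).1 + inner ℝ (p s).2 x = (p t).1 + inner ℝ (p t).2 x}) ?_ ?_
      (T.complex.inter_subset_convexHull hs.1 ht.1 ⟨hxs, hxt⟩)
    · rintro v ⟨hvs, hvt⟩
      exact (hp s hs v hvs).symm.trans (hp t ht v hvt)
    · intro y hy z hz a b _ _ hab
      simp only [Set.mem_ofPred_eq, inner_add_right, real_inner_smul_right] at hy hz ⊢
      linear_combination a * hy + b * hz + ((p t).1 - (p s).1) * hab
  let g : Space d → ℝ := fun x =>
    if hx : ∃ t ∈ S, x ∈ convexHull ℝ (t : Set (Space d)) then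
      (p hx.choose).1 + inner ℝ (p hx.choose).2 x else 0
  have hg : ∀ t ∈ S, ∀ x ∈ convexHull ℝ (t : Set (Space d)),
      g x = (p t).1 + inner ℝ (p t).2 x := by
    intro t ht x hx
    have hx' : ∃ t ∈ S, x ∈ convexHull ℝ (t : Set (Space d)) := ⟨t, ht, hx⟩
    simp only [g, dif_pos hx']
    exact hcons _ hx'.choose_spec.1 t ht x hx'.choose_spec.2 hx
  have hg0 : ∀ x, (∀ τ ∈ T.elements, x ∉ τ) → g x = 0 := by
    intro x hx
    have : ¬ ∃ t ∈ S, x ∈ convexHull ℝ (t : Set (Space d)) :=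
      fun ⟨t, ht, hxt⟩ => hx _ (hSel t ht) hxt
    simp only [g, dif_neg this]
  -- An element containing a point farther than `h` from the support of `φ` has all its vertices
  -- outside that support.
  have hsupp : ∀ x, x ∉ Metric.cthickening h (tsupport φ) → g x = 0 := by
    intro x hx
    by_cases hx' : ∃ t ∈ S, x ∈ convexHull ℝ (t : Set (Space d))
    · obtain ⟨t, ht, hxt⟩ := hx'
      have hv0 : ∀ v ∈ t, φ v = 0 := by
        intro v hv
        by_contra hne
        refine hx (Metric.mem_cthickening_of_dist_le x v h _ (subset_tsupport φ hne) ?_)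
        refine (Metric.dist_le_diam_of_mem (T.isCompact_of_mem_elements (hSel t ht)).isBounded
          hxt (subset_convexHull ℝ _ hv)).trans ?_
        exact (T.diam_le_meshSize (hSel t ht)).trans hh
      rw [hg t ht x hxt]
      refine convexHull_min (t := {x | (p t).1 + inner ℝ (p t).2 x = 0}) ?_ ?_ hxt
      · exact fun v hv => (hp t ht v hv).symm.trans (hv0 v hv)
      · intro y hy z hz a b _ _ hab
        simp only [Set.mem_ofPred_eq, inner_add_right, real_inner_smul_right] at hy hz ⊢
        linear_combination a * hy + b * hz - (p t).1 * hab
    · simp only [g, dif_neg hx']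
  have hcon : ContinuousOn g (closure Ω) := by
    rw [← T.iUnion_elements, Set.biUnion_eq_iUnion]
    have : Finite T.elements := T.finite_elements
    refine (locallyFinite_of_finite _).continuousOn_iUnion
      (fun τ => (T.isCompact_of_mem_elements τ.2).isClosed) ?_
    rintro ⟨τ, t, ht, hc, rfl⟩
    exact ContinuousOn.congr (f := fun x => (p t).1 + inner ℝ (p t).2 x) (by fun_prop)
      (hg t ⟨ht, hc⟩)
  have hgc : Continuous g := by
    rw [continuous_iff_continuousAt]
    intro x
    by_cases hx : x ∈ Ω
    · exact hcon.continuousAt (mem_of_superset (hΩ.mem_nhds hx) subset_closure)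
    · have hx' : x ∈ (Metric.cthickening h (tsupport φ))ᶜ := fun h' => hx (hs h')
      refine (continuousAt_const (y := (0 : ℝ))).congr ?_
      filter_upwards [Metric.isClosed_cthickening.isOpen_compl.mem_nhds hx'] with y hy
      exact (hsupp y hy).symm
  have hts : tsupport g ⊆ Metric.cthickening h (tsupport φ) :=
    closure_minimal (fun x hx => by_contra fun h' => hx (hsupp x h')) Metric.isClosed_cthickening
  refine ⟨g, hgc, ?_, hts.trans hs, ?_, ?_⟩
  · exact (IsCompact.cthickening h2).of_isClosed_subset (isClosed_tsupport g) hts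
  · rintro τ ⟨t, ht, hc, rfl⟩
    exact isPolyOn_affine hn (hg t ⟨ht, hc⟩)
  · refine lipschitzWith_of_finite_closed_cover (h1.continuous.sub hgc) T.finite_elements
      (fun τ hτ => (T.isCompact_of_mem_elements hτ).isClosed) ?_ ?_
    · rintro _ ⟨t, ht, hc, rfl⟩ x hx y hy
      have hel := hSel t ⟨ht, hc⟩
      have h3 := abs_interpolation_error_sub_le hd (T.complex.indep ht) hc
        (h1.differentiable (by simp)) hD (hp t ⟨ht, hc⟩) (hγ _ hel) x hx y hy
      rw [Pi.sub_apply, Pi.sub_apply, hg t ⟨ht, hc⟩ x hx, hg t ⟨ht, hc⟩ y hy]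
      refine h3.trans ?_
      gcongr
      refine le_trans ?_ (Real.le_coe_toNNReal _)
      have := (T.diam_le_meshSize hel).trans hh
      gcongr
    · intro x hx
      have hxΩ : x ∉ Ω := fun h' => by
        have h3 := subset_closure h'
        rw [← T.iUnion_elements] at h3
        obtain ⟨τ, hτ, hxτ⟩ := Set.mem_iUnion₂.1 h3
        exact hx τ hτ hxτ
      have hφx : φ x = 0 := by
        by_contra hne
        exact hxΩ (hs (Metric.self_subset_cthickening _ (subset_tsupport φ hne)))
      rw [Pi.sub_apply, hφx, hg0 x hx, sub_zero]

/-- For a shape regular family of meshes, the finite element spaces are asymptotically dense in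
`H¹₀` as the mesh size tends to zero. -/
theorem exists_mem_feSpace_near (hd : 0 < d) (hΩ : IsOpen Ω) (hb : Bornology.IsBounded Ω)
    {ι : Type*} {T : ι → Triangulation Ω} (hT : ShapeRegular T) {n : ℕ} (hn : 1 ≤ n) (u : H10 Ω)
    {ε : ℝ} (hε : 0 < ε) :
    ∃ δ > 0, ∀ i, (T i).meshSize < δ → ∃ s ∈ feSpace n (T i), ‖u - s‖ < ε := by
  obtain ⟨C, hC0, hC⟩ := exists_H10_of_lipschitz hd hΩ hb
  obtain ⟨γ₀, hγ₀⟩ := hT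
  set γ := max γ₀ 0 with hγ
  obtain ⟨p, ⟨φ, h1, h2, h3, h4, h5⟩, hup⟩ := Metric.mem_closure_iff.1 u.2 (ε / 2) (half_pos hε)
  let w : H10 Ω := ⟨p, (testPairs Ω).le_topologicalClosure ⟨φ, h1, h2, h3, h4, h5⟩⟩
  have hw : w.fn =ᵐ[volume.restrict Ω] φ := h4
  have huw : ‖u - w‖ < ε / 2 := by
    rw [dist_eq_norm] at hup
    exact hup
  obtain ⟨D, hD⟩ := ContDiff.lipschitzWith_of_hasCompactSupport (𝕂 := ℝ) (h2.fderiv ℝ)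
    (h1.fderiv_right (m := 1) (WithTop.coe_le_coe.2 (le_top : (1 + 1 : ℕ∞) ≤ ⊤))) one_ne_zero
  obtain ⟨δ, hδ, hδΩ⟩ := h2.isCompact.exists_cthickening_subset_open hΩ h3
  set m : ℝ := C * (D * (1 + γ)) with hm
  have hγ0 : 0 ≤ γ := le_max_right _ _
  have hm0 : 0 ≤ m := by positivity
  -- The first bound keeps the interpolant supported in `Ω`, and the second makes its error at most
  -- `ε / 2`. Using `m + 1` covers the case `m = 0`.
  refine ⟨min δ (ε / (2 * (m + 1))), by positivity, fun i hi => ?_⟩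
  have hi1 : (T i).meshSize ≤ δ := (hi.trans_le (min_le_left _ _)).le
  have hi2 : (T i).meshSize < ε / (2 * (m + 1)) := hi.trans_le (min_le_right _ _)
  have hi0 : 0 ≤ (T i).meshSize := Real.sSup_nonneg (by
    rintro _ ⟨τ, _, rfl⟩; exact Metric.diam_nonneg)
  obtain ⟨g, g1, g2, g3, g4, g5⟩ := (T i).exists_interpolant hd hΩ hn h1 h2 hD hγ0
    (fun τ hτ => (hγ₀ i τ hτ).trans (le_max_left _ _)) le_rfl
    ((Metric.cthickening_mono hi1 _).trans hδΩ)
  have hfs : tsupport (φ - g) ⊆ Ω := (tsupport_sub φ g).trans (Set.union_subset h3 g3)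
  obtain ⟨v, hv1, hv2⟩ := hC (φ - g) _ g5 (h2.sub g2) hfs
  -- The interpolant is realised in `H¹₀` as test function minus error, so only the error has to be
  -- placed in `H¹₀` and estimated.
  refine ⟨w - v, ⟨g, g1.continuousOn, g4, fun x hx => ?_, ?_⟩, ?_⟩
  · refine image_eq_zero_of_notMem_tsupport fun hxg => ?_
    rw [hΩ.frontier_eq] at hx
    exact hx.2 (g3 hxg)
  · have hsub : (w - v).fn = w.fn - v.fn := rfl
    rw [hsub]
    filter_upwards [Lp.coeFn_sub w.fn v.fn, hw, hv1] with x k1 k2 k3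
    rw [k1, Pi.sub_apply, k2, k3, Pi.sub_apply, sub_sub_cancel]
  · have hv3 : ‖v‖ ≤ m * (T i).meshSize := by
      rw [Real.coe_toNNReal _ (by positivity)] at hv2
      refine hv2.trans (le_of_eq ?_)
      rw [hm]; ring
    have hv4 : m * (T i).meshSize ≤ ε / 2 := by
      have h6 : m * (T i).meshSize ≤ (m + 1) * (ε / (2 * (m + 1))) := by gcongr; linarith
      refine h6.trans (le_of_eq ?_)
      field_simp
    calc ‖u - (w - v)‖ = ‖(u - w) + v‖ := by rw [sub_add]
      _ ≤ ‖u - w‖ + ‖v‖ := norm_add_le _ _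
      _ < ε := by linarith

end Density

/-! ### Compact perturbations and Galerkin orthogonality in Hilbert space -/

/-- A bounded family which is small for small values of a parameter is dominated by a function of
the parameter which tends to zero. -/
theorem exists_tendsto_zero_dominating {ι : Type*} {ρ m : ι → ℝ} {M : ℝ} (hM : 0 ≤ M)
    (h0 : ∀ i, 0 ≤ ρ i) (hρM : ∀ i, ρ i ≤ M)
    (hρ : ∀ ε > 0, ∃ δ > 0, ∀ i, m i < δ → ρ i ≤ ε) :
    ∃ k : ℝ → ℝ, (∀ h, 0 ≤ k h) ∧ (∀ h, k h ≤ M) ∧ Tendsto k (𝓝[>] 0) (𝓝 0) ∧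
      ∀ i, ρ i ≤ k (m i) := by
  -- Several meshes may share the same size, so the supremum over all of them is taken. It is `0`
  -- when there is none.
  refine ⟨fun h => ⨆ i : {i // m i = h}, ρ i, fun h => Real.iSup_nonneg fun i => h0 i,
    fun h => Real.iSup_le (fun i => hρM i) hM, ?_, fun i => ?_⟩
  · rw [Metric.tendsto_nhds]
    intro ε hε
    obtain ⟨δ, hδ, h⟩ := hρ (ε / 2) (half_pos hε)
    filter_upwards [mem_nhdsWithin_of_mem_nhds (Iio_mem_nhds hδ)] with x hx
    rw [Real.dist_0_eq_abs, abs_of_nonneg (Real.iSup_nonneg fun i : {i // m i = x} => h0 i)]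
    refine lt_of_le_of_lt (Real.iSup_le (fun i => h i ?_) (half_pos hε).le) (half_lt_self hε)
    rw [i.2]; exact hx
  · exact le_ciSup (f := fun j : {j // m j = m i} => ρ j)
      ⟨M, by rintro _ ⟨j, rfl⟩; exact hρM j⟩ ⟨i, rfl⟩

section Abstract

variable {H : Type*} [NormedAddCommGroup H] [InnerProductSpace ℝ H]

theorem sqrt_bilin_add_le {B : H →L[ℝ] H →L[ℝ] ℝ} (hs : ∀ x y, B x y = B y x)
    (h0 : ∀ x, 0 ≤ B x x) (x y : H) : √(B (x + y) (x + y)) ≤ √(B x x) + √(B y y) := by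
  have hcs : B x y ≤ √(B x x) * √(B y y) := by
    rw [← Real.sqrt_mul (h0 x)]
    have h1 := LinearMap.BilinForm.apply_mul_apply_le_of_forall_zero_le
      (LinearMap.mk₂ ℝ (fun x y => B x y) (by simp) (by simp) (by simp) (by simp)) h0 x y
    simp only [LinearMap.mk₂_apply] at h1
    refine Real.le_sqrt_of_sq_le ?_
    rw [sq]
    rwa [hs y x] at h1
  rw [Real.sqrt_le_left (by positivity)]
  have h2 : B (x + y) (x + y) = B x x + 2 * B x y + B y y := by
    simp only [map_add, add_apply, hs y x]; ring
  rw [h2, add_sq, Real.sq_sqrt (h0 x), Real.sq_sqrt (h0 y)]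
  linarith

theorem abs_sqrt_bilin_sub_le {B : H →L[ℝ] H →L[ℝ] ℝ} (hs : ∀ x y, B x y = B y x)
    (h0 : ∀ x, 0 ≤ B x x) (x y : H) :
    |√(B x x) - √(B y y)| ≤ √(B (x - y) (x - y)) := by
  have h1 := sqrt_bilin_add_le hs h0 (x - y) y
  have h2 := sqrt_bilin_add_le hs h0 (y - x) x
  have h3 : B (y - x) (y - x) = B (x - y) (x - y) := by
    rw [← neg_sub x y, map_neg B, neg_apply, map_neg (B (x - y)), neg_neg]
  rw [sub_add_cancel] at h1 h2
  rw [h3] at h2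
  rw [abs_le]
  constructor <;> linarith

variable [CompleteSpace H]

/-- A compact operator is small on the vectors which are orthogonal, with respect to a coercive
symmetric form, to an asymptotically dense family of sets. -/
theorem eventually_norm_le_of_orthogonal {B : H →L[ℝ] H →L[ℝ] ℝ}
    (hs : ∀ x y, B x y = B y x) (hB : IsCoercive B) {N : H →L[ℝ] H} (hN : IsCompactOperator N)
    {ι : Type*} {l : Filter ι} {S : ι → Set H}
    (hS : ∀ y, ∀ ε > 0, ∀ᶠ i in l, ∃ s ∈ S i, ‖y - s‖ < ε) {ε : ℝ} (hε : 0 < ε) :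
    ∀ᶠ i in l, ∀ z, (∀ s ∈ S i, B z s = 0) → ‖N z‖ ≤ ε * ‖z‖ := by
  have htb : TotallyBounded (N '' Metric.closedBall 0 1) :=
    (hN.isCompact_closure_image_closedBall (𝕜₁ := ℝ) (f := (N : H →ₗ[ℝ] H)) 1).totallyBounded.subset
      subset_closure
  set η := ε ^ 2 / (2 * (‖N‖ + 1)) with hη
  have hη0 : 0 < η := by positivity
  obtain ⟨t, ht, htc⟩ := Metric.totallyBounded_iff.1 htb η hη0
  -- `q y` represents `⟨N ·, y⟩` through `B`. For `z` orthogonal to `S i` this gives `⟨N z, y⟩ = B z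
  -- (q y - s)`, which is small as soon as `S i` approximates `q y`. Compactness reduces the task to
  -- finitely many `y`.
  let q : H → H := fun y => hB.continuousLinearEquivOfBilin.symm (ContinuousLinearMap.adjoint N y)
  have hq : ∀ z y, inner ℝ (N z) y = B z (q y) := by
    intro z y
    rw [hs, ← hB.continuousLinearEquivOfBilin_apply, ContinuousLinearEquiv.apply_symm_apply,
      ContinuousLinearMap.adjoint_inner_left, real_inner_comm]
  have hev : ∀ᶠ i in l, ∀ y ∈ t, ∃ s ∈ S i, ‖q y - s‖ < ε ^ 2 / (2 * (‖B‖ + 1)) :=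
    (ht.eventually_all).2 fun y _ => hS (q y) _ (by positivity)
  refine hev.mono fun i hi z hz => ?_
  have hunit : ∀ z, ‖z‖ ≤ 1 → (∀ s ∈ S i, B z s = 0) → ‖N z‖ ≤ ε := by
    intro z hz1 hz
    obtain ⟨y, hy, hzy⟩ := Set.mem_iUnion₂.1 (htc ⟨z, by simpa using hz1, rfl⟩)
    obtain ⟨s, hs', hys⟩ := hi y hy
    rw [Metric.mem_ball, dist_eq_norm] at hzy
    have h1 : ‖N z‖ ^ 2 = inner ℝ (N z) (N z - y) + B z (q y - s) := by
      rw [map_sub, hz s hs', sub_zero, ← hq, ← inner_add_right, sub_add_cancel,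
        real_inner_self_eq_norm_sq]
    have h2 : inner ℝ (N z) (N z - y) ≤ ‖N‖ * η := by
      refine (real_inner_le_norm _ _).trans ?_
      have := N.le_of_opNorm_le_of_le le_rfl hz1
      rw [mul_one] at this
      gcongr
    have h3 : B z (q y - s) ≤ ‖B‖ * (ε ^ 2 / (2 * (‖B‖ + 1))) := by
      refine (le_abs_self _).trans ((B.le_opNorm₂ z (q y - s)).trans ?_)
      have : ‖B‖ * ‖z‖ ≤ ‖B‖ * 1 := by gcongr
      rw [mul_one] at this
      gcongr
    have h4 : ∀ a : ℝ, 0 ≤ a → a * (ε ^ 2 / (2 * (a + 1))) ≤ ε ^ 2 / 2 := by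
      intro a ha
      have : a * (ε ^ 2 / (2 * (a + 1))) ≤ (a + 1) * (ε ^ 2 / (2 * (a + 1))) := by
        gcongr; linarith
      refine this.trans (le_of_eq ?_)
      field_simp
    have h5 := h4 ‖N‖ (norm_nonneg _)
    have h6 := h4 ‖B‖ (by positivity)
    refine abs_le_of_sq_le_sq' ?_ hε.le |>.2
    rw [h1]
    rw [hη] at h2
    linarith
  rcases eq_or_ne z 0 with rfl | hz0
  · simp
  have hzp : 0 < ‖z‖ := norm_pos_iff.2 hz0
  have h7 := hunit (‖z‖⁻¹ • z) (by simp [norm_smul, hzp.ne'])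
    (fun s hs' => by simp [hz s hs'])
  rw [map_smul, norm_smul, norm_inv, norm_norm, inv_mul_le_iff₀ hzp] at h7
  linarith

/-- If `1 + M` is injective and `M` is compact, then `M` factors through `1 + M` by a compact
operator. -/
theorem exists_comp_one_add_eq_of_isCompactOperator {M : H →L[ℝ] H} (hM : IsCompactOperator M)
    (hinj : ∀ x, x + M x = 0 → x = 0) :
    ∃ N : H →L[ℝ] H, IsCompactOperator N ∧ ∀ x, N (x + M x) = M x := by
  rcases hM.hasEigenvalue_or_mem_resolventSet (μ := (-1 : ℝ)) (by norm_num) with h | h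
  · obtain ⟨x, hx⟩ := h.exists_hasEigenvector
    have h1 : M x = (-1 : ℝ) • x := hx.apply_eq_smul
    exact absurd (hinj x (by rw [h1]; simp)) hx.2
  · obtain ⟨U, hU⟩ := spectrum.mem_resolventSet_iff.1 h
    -- Here `U = -1 - M`, so this operator is `(1 + M)⁻¹ M`, and `M` commutes with `1 + M`.
    refine ⟨-(U⁻¹ : (H →L[ℝ] H)ˣ).1.comp M, ?_, fun x => ?_⟩
    · exact (hM.clm_comp (U⁻¹ : (H →L[ℝ] H)ˣ).1).neg
    · have h2 : ∀ y, (U⁻¹ : (H →L[ℝ] H)ˣ).1 (U.1 y) = y := fun y => by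
        rw [← mul_apply_eq_comp, Units.inv_mul, one_apply_eq_self]
      have h3 : M (x + M x) = -(U.1 (M x)) := by
        rw [hU]
        simp [Algebra.algebraMap_eq_smul_one, add_comm]
      have h4 : (-(U⁻¹ : (H →L[ℝ] H)ˣ).1.comp M) (x + M x) =
          -((U⁻¹ : (H →L[ℝ] H)ˣ).1 (M (x + M x))) := rfl
      rw [h4, h3, map_neg, h2, neg_neg]

/-- A compact operator is small on the vectors which are orthogonal to an asymptotically dense family
of subspaces, with a bound depending only on the parameter of the family. -/
theorem exists_norm_le_of_orthogonal {B : H →L[ℝ] H →L[ℝ] ℝ}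
    (hs : ∀ x y, B x y = B y x) (hB : IsCoercive B) {N : H →L[ℝ] H} (hN : IsCompactOperator N)
    {ι : Type*} {S : ι → Submodule ℝ H} {m : ι → ℝ} (hm : ∀ i, 0 < m i)
    (hS : ∀ y, ∀ ε > 0, ∃ δ > 0, ∀ i, m i < δ → ∃ s ∈ S i, ‖y - s‖ < ε) :
    ∃ k : ℝ → ℝ, (∀ h, 0 ≤ k h) ∧ (∀ h, k h ≤ ‖N‖) ∧ Tendsto k (𝓝[>] 0) (𝓝 0) ∧
      ∀ i z, (∀ s ∈ S i, B z s = 0) → ‖N z‖ ≤ k (m i) * ‖z‖ := by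
  -- The `B`-orthogonal complement of `S i`. The modulus sought is the operator norm of `N`
  -- restricted to it.
  let Z : ι → Submodule ℝ H := fun i => ⨅ s : S i, LinearMap.ker (B.flip s).toLinearMap
  have hZ : ∀ i z, z ∈ Z i ↔ ∀ s ∈ S i, B z s = 0 := fun i z => by
    simp [Z, Submodule.mem_iInf]
  have hsmall : ∀ ε > 0, ∃ δ > 0, ∀ i, m i < δ → ‖N.comp (Z i).subtypeL‖ ≤ ε := by
    intro ε hε
    have h := eventually_norm_le_of_orthogonal hs hB hN (l := comap m (𝓝[>] 0))
      (S := fun i => (S i : Set H)) (fun y η hη => ?_) hε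
    · obtain ⟨t, ht, hti⟩ := mem_comap.1 h
      obtain ⟨δ, hδ, hδt⟩ := mem_nhdsGT_iff_exists_Ioo_subset.1 ht
      refine ⟨δ, hδ, fun i hi => ContinuousLinearMap.opNorm_le_bound _ hε.le fun z => ?_⟩
      exact hti (hδt ⟨hm i, hi⟩) z ((hZ i z).1 z.2)
    · obtain ⟨δ, hδ, hi⟩ := hS y η hη
      exact mem_comap.2 ⟨Set.Iio δ, mem_nhdsWithin_of_mem_nhds (Iio_mem_nhds hδ), fun i h => hi i h⟩
  obtain ⟨k, hk0, hkN, hk, hki⟩ := exists_tendsto_zero_dominating (norm_nonneg N)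
    (fun i => norm_nonneg (N.comp (Z i).subtypeL)) (fun i => by
      refine ContinuousLinearMap.opNorm_le_bound _ (norm_nonneg N) fun z => ?_
      exact N.le_opNorm z) hsmall
  refine ⟨k, hk0, hkN, hk, fun i z hz => ?_⟩
  have h1 := (N.comp (Z i).subtypeL).le_opNorm ⟨z, (hZ i z).2 hz⟩
  exact h1.trans (mul_le_mul_of_nonneg_right (hki i) (norm_nonneg z))

end Abstract

/-! ### The error identity for compact perturbations in Hilbert space. -/

section AbstractEstimate

/-- Test with `x - y` itself. The choice `S = ⊤` yields uniqueness for the full problem, and a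
general `S` yields uniqueness of the Galerkin projection. -/
theorem eq_of_isCoercive_of_forall_eq {H : Type*} [NormedAddCommGroup H] [NormedSpace ℝ H]
    {B : H →L[ℝ] H →L[ℝ] ℝ} (hc : IsCoercive B) {S : Submodule ℝ H} {x y : H}
    (hxy : x - y ∈ S) (h : ∀ v ∈ S, B x v = B y v) : x = y := by
  obtain ⟨c, hc0, hc⟩ := hc
  have h1 := hc (x - y)
  rw [map_sub B, sub_apply, h _ hxy, sub_self] at h1
  have h2 : ‖x - y‖ = 0 := by
    by_contra h3
    have h4 : 0 < ‖x - y‖ := lt_of_le_of_ne (norm_nonneg _) (Ne.symm h3)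
    have : 0 < c * ‖x - y‖ * ‖x - y‖ := by positivity
    linarith
  exact sub_eq_zero.1 (norm_eq_zero.1 h2)

variable {H : Type*} [NormedAddCommGroup H] [InnerProductSpace ℝ H] [CompleteSpace H]

/-- The a posteriori identity in an abstract setting: for a compact perturbation of a coercive
symmetric form and asymptotically dense subspaces `S i`, the energy norm of the error agrees up to
terms of higher order with the energy norm of the residual correction `w i - uh i`. -/
theorem exists_abs_energy_sub_le {L : Type*} [NormedAddCommGroup L] [InnerProductSpace ℝ L]
    {B : H →L[ℝ] H →L[ℝ] ℝ} (hs : ∀ x y, B x y = B y x) (hco : IsCoercive B) {J : H → L}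
    {K : L →L[ℝ] H} (hK : IsCompactOperator K) (hKB : ∀ f v, B (K f) v = inner ℝ f (J v))
    {V : H →L[ℝ] L} (hV : ∀ w, (∀ v, B w v + inner ℝ (V w) (J v) = 0) → w = 0)
    {ι : Type*} {S : ι → Submodule ℝ H} {m : ι → ℝ} (hm : ∀ i, 0 < m i)
    (hS : ∀ y, ∀ ε > 0, ∃ δ > 0, ∀ i, m i < δ → ∃ s ∈ S i, ‖y - s‖ < ε)
    {F : L} {Fh : ι → L} {u : H} {uh : ι → H}
    (hu : ∀ v, B u v + inner ℝ (V u) (J v) = inner ℝ F (J v))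
    (huh : ∀ i, ∀ v ∈ S i, B (uh i) v + inner ℝ (V (uh i)) (J v) = inner ℝ (Fh i) (J v))
    {κ₁ : ℝ → ℝ} (hκ₁ : ∀ h > 0, κ₁ h ∈ Set.Ioo (0 : ℝ) 1)
    (hκ₁_lim : Tendsto κ₁ (𝓝[>] 0) (𝓝 0)) {C₁ : ℝ}
    (hℓ : ∀ i, √(B (K (F - Fh i)) (K (F - Fh i))) ≤
      C₁ * κ₁ (m i) * √(B (u - uh i) (u - uh i))) :
    ∃ κ : ℝ → ℝ, (∀ h > 0, κ h ∈ Set.Ioo (0 : ℝ) 1) ∧ Tendsto κ (𝓝[>] 0) (𝓝 0) ∧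
      ∃ C : ℝ, ∀ i,
        |√(B (u - uh i) (u - uh i)) - √(B (K (Fh i - V (uh i)) - uh i)
          (K (Fh i - V (uh i)) - uh i))| ≤ C * κ (m i) * √(B (u - uh i) (u - uh i)) := by
  have hM : IsCompactOperator (K.comp V) := hK.comp_clm V
  have hB0 : ∀ x, 0 ≤ B x x := fun x => by
    obtain ⟨c, hc0, hcB⟩ := hco
    exact le_trans (by positivity) (hcB x)
  obtain ⟨N, hN, hNM⟩ := exists_comp_one_add_eq_of_isCompactOperator hM (fun w hw => hV w fun v => by
    rw [← hKB, ← add_apply, ← map_add]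
    have hw' : w + K (V w) = 0 := hw
    rw [hw', map_zero, zero_apply])
  obtain ⟨k, hk0, hkN, hk, hkz⟩ := exists_norm_le_of_orthogonal hs hco hN hm hS
  obtain ⟨c, hc0, hcB⟩ := id hco
  have hlow : ∀ x : H, ‖x‖ ≤ (√c)⁻¹ * √(B x x) := by
    intro x
    rw [inv_mul_eq_div, le_div_iff₀ (by positivity)]
    refine Real.le_sqrt_of_sq_le ?_
    rw [mul_pow, Real.sq_sqrt hc0.le, mul_comm, sq, ← mul_assoc]
    exact hcB x
  have hup : ∀ x : H, √(B x x) ≤ √‖B‖ * ‖x‖ := by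
    intro x
    rw [Real.sqrt_le_left (by positivity), mul_pow, Real.sq_sqrt (by positivity), sq,
      ← mul_assoc]
    exact (le_abs_self _).trans (B.le_opNorm₂ x x)
  -- The quotient `k / (k + 1)` brings `k` below `1`. It may vanish, but averaging with `κ₁ > 0`
  -- puts the result in `(0, 1)`. The leading factor `2` in the constant below compensates for the
  -- halving.
  refine ⟨fun h => (κ₁ h + k h / (k h + 1)) / 2, fun h hh => ?_, ?_, ?_⟩
  · obtain ⟨h1, h2⟩ := hκ₁ h hh
    have h3 : 0 ≤ k h / (k h + 1) := div_nonneg (hk0 h) (by linarith [hk0 h])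
    have h4 : k h / (k h + 1) < 1 := by
      rw [div_lt_one (by linarith [hk0 h])]; linarith
    constructor <;> linarith
  · have h1 : Tendsto (fun h => k h / (k h + 1)) (𝓝[>] 0) (𝓝 (0 / (0 + 1))) :=
      hk.div (hk.add_const 1) (by norm_num)
    simpa using (hκ₁_lim.add h1).div_const 2
  set a := (√c)⁻¹ with ha
  set b := √‖B‖ with hbdef
  have ha0 : 0 ≤ a := by positivity
  have hb0 : 0 ≤ b := by positivity
  refine ⟨2 * (|C₁| + b * (2 * ‖N‖ * a * |C₁|) +
    b * ((‖N‖ + 1) * (1 + ‖K.comp V‖) * a)), fun i => ?_⟩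
  set w : H := K (Fh i - V (uh i)) with hw
  set h := m i with hh
  have hh0 : 0 < h := hm i
  set e : H := u - (uh i : H) with he
  set r : H := K (F - Fh i) with hr
  have horth : ∀ v ∈ S i, B (w - (uh i : H)) v = 0 := by
    intro v hv
    have h1 := huh i v hv
    rw [hw, map_sub B, sub_apply, hKB, inner_sub_left]
    linarith
  set z : H := w - (uh i : H) with hz
  have huK : u = K (F - V u) := by
    refine eq_of_isCoercive_of_forall_eq hco (S := ⊤) trivial fun v _ => ?_
    rw [hKB, inner_sub_left]
    linarith [hu v]
  have hez : e - z = r - K (V e) := by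
    have h1 : e - z = u - w := by rw [he, hz]; abel
    rw [h1, hw, hr, he]
    nth_rewrite 1 [huK]
    simp only [map_sub]
    abel
  have hNe : K (V e) = N r + N z := by
    have h1 : e + (K.comp V) e = r + z := by
      rw [ContinuousLinearMap.comp_apply]
      nth_rewrite 1 [sub_eq_iff_eq_add.1 hez]
      abel
    rw [← map_add, ← h1, hNM]
    rfl
  have hrE : √(B r r) ≤ |C₁| * κ₁ h * √(B e e) := by
    have h1 := hℓ i
    refine h1.trans ?_
    have h2 := (hκ₁ h hh0).1.le
    have h3 : 0 ≤ √(B e e) := Real.sqrt_nonneg _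
    have h4 := le_abs_self C₁
    gcongr
  set E := √(B e e) with hE
  have hE0 : 0 ≤ E := Real.sqrt_nonneg _
  have hκ0 : 0 < κ₁ h := (hκ₁ h hh0).1
  have hre : ‖r‖ ≤ a * (|C₁| * κ₁ h * E) := (hlow r).trans (by gcongr)
  have heE : ‖e‖ ≤ a * E := hlow e
  have hzn : ‖z‖ ≤ ‖r‖ + (1 + ‖K.comp V‖) * ‖e‖ := by
    have h1 : z = e - r + (K.comp V) e := by
      have h2 : (K.comp V) e = r - (e - z) := by rw [hez]; simp
      rw [h2]; abel
    rw [h1]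
    refine (norm_add_le _ _).trans ?_
    have h2 := (K.comp V).le_opNorm e
    have h3 := norm_sub_le e r
    linarith
  -- Since `k ≤ ‖N‖`, passing from `k` to `k / (k + 1)` costs only a fixed factor.
  have hkn : k h ≤ (‖N‖ + 1) * (k h / (k h + 1)) := by
    have h1 : 0 < k h + 1 := by linarith [hk0 h]
    rw [mul_div_assoc', le_div_iff₀ h1, mul_comm]
    exact mul_le_mul_of_nonneg_right (by linarith [hkN h]) (hk0 h)
  have hMe : ‖K (V e)‖ ≤ 2 * ‖N‖ * a * |C₁| * κ₁ h * E +
      (‖N‖ + 1) * (1 + ‖K.comp V‖) * a * (k h / (k h + 1)) * E := by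
    calc ‖K (V e)‖ ≤ ‖N r‖ + ‖N z‖ := by rw [hNe]; exact norm_add_le _ _
      _ ≤ ‖N‖ * ‖r‖ + k h * (‖r‖ + (1 + ‖K.comp V‖) * ‖e‖) := by
          have h1 := (hkz i z horth).trans (mul_le_mul_of_nonneg_left hzn (hk0 h))
          linarith [N.le_opNorm r]
      _ = (‖N‖ + k h) * ‖r‖ + k h * ((1 + ‖K.comp V‖) * ‖e‖) := by ring
      _ ≤ (‖N‖ + ‖N‖) * (a * (|C₁| * κ₁ h * E)) +
          (‖N‖ + 1) * (k h / (k h + 1)) * ((1 + ‖K.comp V‖) * (a * E)) := by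
          have := hkN h
          have := hk0 h
          gcongr
      _ = _ := by ring
  have hfin : |E - √(B z z)| ≤ |C₁| * κ₁ h * E + b * ‖K (V e)‖ := by
    refine (abs_sqrt_bilin_sub_le hs hB0 e z).trans ?_
    rw [hez, sub_eq_add_neg]
    refine (sqrt_bilin_add_le hs hB0 _ _).trans ?_
    refine add_le_add hrE ((hup _).trans ?_)
    rw [norm_neg]
  refine hfin.trans ?_
  have hq0 : 0 ≤ k h / (k h + 1) := div_nonneg (hk0 h) (by linarith [hk0 h])
  set q := k h / (k h + 1) with hq
  have h1 : b * ‖K (V e)‖ ≤ b * (2 * ‖N‖ * a * |C₁| * κ₁ h * E +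
      (‖N‖ + 1) * (1 + ‖K.comp V‖) * a * q * E) := by gcongr
  have h2 : 0 ≤ |C₁| * q * E := by positivity
  have h3 : 0 ≤ b * (2 * ‖N‖ * a * |C₁|) * q * E := by positivity
  have h4 : 0 ≤ b * ((‖N‖ + 1) * (1 + ‖K.comp V‖) * a) * κ₁ h * E := by positivity
  linarith

end AbstractEstimate

/-! ### The solution operator and the Galerkin projection -/

section Operators

variable {d : ℕ} {Ω : Set (Space d)} {A : Space d → Matrix (Fin d) (Fin d) ℝ}
  {B : H10 Ω →L[ℝ] H10 Ω →L[ℝ] ℝ}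

/-- A solution makes the `epsilon` choice satisfy its defining property, and coercivity leaves only
one candidate. -/
theorem solutionOp_eq (hB : ∀ u v, B u v = energyForm A u v) (hc : IsCoercive B) {f : L2 Ω}
    {w : H10 Ω} (hw : ∀ v, B w v = inner ℝ f v.fn) : solutionOp A f = w := by
  have h := Classical.epsilon_spec
    (p := fun w : H10 Ω => ∀ v : H10 Ω, energyForm A w v = inner ℝ f v.fn)
    ⟨w, fun v => by rw [← hB, hw]⟩
  refine eq_of_isCoercive_of_forall_eq hc (S := ⊤) trivial fun v _ => ?_
  rw [hw, hB]
  exact h v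

theorem galerkinProj_eq (hB : ∀ u v, B u v = energyForm A u v) (hc : IsCoercive B)
    {S : Submodule ℝ (H10 Ω)} {w p : H10 Ω} (hp : p ∈ S) (h : ∀ v ∈ S, B (w - p) v = 0) :
    galerkinProj A S w = p := by
  have hs := Classical.epsilon_spec
    (p := fun p : H10 Ω => p ∈ S ∧ ∀ v ∈ S, energyForm A (w - p) v = 0)
    ⟨p, hp, fun v hv => by rw [← hB, h v hv]⟩
  refine eq_of_isCoercive_of_forall_eq hc (S := S) (S.sub_mem hs.1 hp) fun v hv => ?_
  have h1 : B (w - galerkinProj A S w) v = 0 := by rw [hB]; exact hs.2 v hv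
  have h2 := h v hv
  rw [map_sub B, sub_apply] at h1 h2
  linarith

/-- The operator `K : L² → H¹₀` as a compact continuous linear map. -/
theorem exists_isCompactOperator_solution (hΩ : IsOpen Ω) (hb : Bornology.IsBounded Ω)
    (hc : IsCoercive B) :
    ∃ K : L2 Ω →L[ℝ] H10 Ω, IsCompactOperator K ∧ ∀ f v, B (K f) v = inner ℝ f v.fn := by
  refine ⟨(hc.continuousLinearEquivOfBilin.symm : H10 Ω →L[ℝ] H10 Ω).comp
    (ContinuousLinearMap.adjoint (H10.fnL Ω)), ?_, fun f v => ?_⟩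
  · exact (isCompactOperator_adjoint_fnL hΩ hb).clm_comp
      (hc.continuousLinearEquivOfBilin.symm : H10 Ω →L[ℝ] H10 Ω)
  · rw [← hc.continuousLinearEquivOfBilin_apply, ContinuousLinearMap.comp_apply,
      ContinuousLinearEquiv.coe_coe, ContinuousLinearEquiv.apply_symm_apply,
      ContinuousLinearMap.adjoint_inner_left, H10.fnL_apply]

end Operators

end GalerkinFEM

theorem theorem3p1 {d : ℕ} (hd : 2 ≤ d) {Ω : Set (Space d)} (hΩ : IsPolytopicDomain Ω)
    (T₀ : Triangulation Ω) (A : Space d → Matrix (Fin d) (Fin d) ℝ)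
    (hA : IsEllipticCoefficient T₀ A)
    -- a shape regular family of meshes, and the finite element spaces of degree `n` over them
    {ι : Type*} (T : ι → Triangulation Ω) (hT : ShapeRegular T) (n : ℕ) (hn : 1 ≤ n)
    (V : H10 Ω →L[ℝ] L2 Ω)
    -- the homogeneous problem `a(w, v) + (V w, v) = 0` has only the trivial solution
    (hV : ∀ w : H10 Ω, (∀ v : H10 Ω, energyForm A w v + inner ℝ (V w) v.fn = 0) → w = 0)
    (ℓ : H10 Ω → L2 Ω) (ℓh : (i : ι) → feSpace n (T i) → L2 Ω)
    -- the exact solution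
    (u : H10 Ω)
    (hu : ∀ v : H10 Ω, energyForm A u v + inner ℝ (V u) v.fn = inner ℝ (ℓ u) v.fn)
    -- the discrete solutions
    (uh : (i : ι) → feSpace n (T i))
    (huh : ∀ i, ∀ v ∈ feSpace n (T i),
      energyForm A (uh i) v + inner ℝ (V (uh i)) v.fn = inner ℝ (ℓh i (uh i)) v.fn)
    -- `‖K(ℓ u - ℓ_h u_h)‖_a = O(κ₁(h)) ‖u - u_h‖_a`
    (κ₁ : ℝ → ℝ) (hκ₁ : ∀ h > 0, κ₁ h ∈ Set.Ioo (0 : ℝ) 1)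
    (hκ₁_lim : Tendsto κ₁ (𝓝[>] 0) (𝓝 0))
    (C₁ : ℝ) (hℓ : ∀ i, energyNorm A (solutionOp A (ℓ u - ℓh i (uh i))) ≤
      C₁ * κ₁ (T i).meshSize * energyNorm A (u - (uh i : H10 Ω))) :
    ∃ κ : ℝ → ℝ, (∀ h > 0, κ h ∈ Set.Ioo (0 : ℝ) 1) ∧ Tendsto κ (𝓝[>] 0) (𝓝 0) ∧
      ∃ C : ℝ, ∀ i,
        let w : H10 Ω := solutionOp A (ℓh i (uh i) - V (uh i))
        |energyNorm A (u - (uh i : H10 Ω)) - energyNorm A (w - galerkinProj A (feSpace n (T i)) w)| ≤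
          C * κ (T i).meshSize * energyNorm A (u - (uh i : H10 Ω)) := by
  have hd0 : 0 < d := by omega
  have hΩo := hΩ.isOpen
  have hb := hΩ.isBounded
  obtain ⟨B, hB⟩ := hA.exists_bilin
  obtain ⟨c, hc0, hcB⟩ := hA.exists_coercive hd0 hΩo hb
  have hco : IsCoercive B := ⟨c, hc0, fun x => by rw [hB, mul_assoc, ← sq]; exact hcB x⟩
  have hs : ∀ x y, B x y = B y x := fun x y => by
    rw [hB, hB, hA.energyForm_comm hΩo.measurableSet]
  obtain ⟨K, hK, hKB⟩ := exists_isCompactOperator_solution hΩo hb hco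
  have hsol : ∀ f, solutionOp A f = K f := fun f => solutionOp_eq hB hco (hKB f)
  have hen : ∀ x : H10 Ω, energyNorm A x = √(B x x) := fun x => by rw [energyNorm, hB]
  -- The discrete equation is precisely the Galerkin orthogonality of `w - u_h`, hence `P_h w =
  -- u_h`.
  have hproj : ∀ i, galerkinProj A (feSpace n (T i)) (K (ℓh i (uh i) - V (uh i))) = uh i := by
    refine fun i => galerkinProj_eq hB hco (uh i).2 fun v hv => ?_
    have h1 := huh i v hv
    rw [map_sub B, sub_apply, hKB, hB, inner_sub_left]
    linarith
  simp only [← hB] at hV hu huh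
  simp only [hen, hsol] at hℓ
  simp only [hen, hsol, hproj]
  exact exists_abs_energy_sub_le hs hco hK hKB hV
    (fun i => (T i).meshSize_pos hd0 hΩ.isConnected.nonempty)
    (fun y _ hε => exists_mem_feSpace_near hd0 hΩo hb hT hn y hε)
    hu huh hκ₁ hκ₁_lim hℓ
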